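/- **Model.** A unit mass of students attends infinitesimally small schools of finitely many types $i\in I$; type $i$ has a share $w_i>0$ of the students ($\sum_i w_i=1$), whose abilities have a distribution $F_i$ on $[0,1]$. There is a unit mass of jobs, whose qualities have a distribution $\mu$ with a positive density on $[0,1]$. A transcript structure for type $i$ is a (possibly randomized) map from true abilities to grades such that the mean true ability of the students of the school who receive grade $\hat a$ is $\hat a$; let $G_i$ be the resulting distribution of grades and $G=\sum_i w_iG_i$. Students are matched to jobs monotonically in their grades (ties are broken uniformly at random); the desirability mapping $Q(\hat a)$ is the expected quality of the job matched with a student of grade $\hat a$. A profile of transcript structures is an equilibrium if, for every type $i$, $\int_0^1 Q\,dG_i\ge\int_0^1 Q\,d\hat G_i$ for the grade distribution $\hat G_i$ of every alternative transcript structure of type $i$, with $Q$ kept fixed. It is connected if every point strictly between the lowest and the highest grade produced has a neighbourhood all of whose points are grades produced by the schools of a single type. The welfare of a profile is the expected value of $aq$, where $a$ is the true ability of a random student and $q$ is the quality of the job he is matched with; the truthful profile is the one in which every grade equals the true ability. The price of anarchy is the supremum, over the connected equilibria, of the ratio of the welfare of the truthful profile to the welfare of the equilibrium. **Theorem.** If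 the aggregate ability distribution $\sum_i w_iF_i$ is uniform on $[0,1]$, then the price of anarchy of the strategic grading game is at most $1.36$. -/

import Mathlib

open MeasureTheory ProbabilityTheory Set
open scoped NNReal ENNReal

noncomputable section

namespace Grading

/-- The primitives of the grading game with finitely many types of (infinitesimally small) schools.
Job qualities have a distribution on `[0,1]` with a positive density; schools of type `i` hold a
fraction `weight i` of the unit mass of students, and the true abilities of their students are
distributed on `[0,1]` according to `ability i`. The mass of jobs equals the mass of students. -/
structure Market (ι : Type*) [Fintype ι] where
  jobDensity : ℝ → ℝ≥0∞
  measurable_jobDensity : Measurable jobDensity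
  jobDensity_pos : ∀ q ∈ Icc (0 : ℝ) 1, 0 < jobDensity q
  lintegral_jobDensity : ∫⁻ q in Icc (0 : ℝ) 1, jobDensity q = 1
  weight : ι → ℝ≥0
  weight_pos : ∀ i, 0 < weight i
  sum_weight : ∑ i, weight i = 1
  ability : ι → Measure ℝ
  ability_prob : ∀ i, IsProbabilityMeasure (ability i)
  ability_supp : ∀ i, ∀ᵐ a ∂(ability i), a ∈ Icc (0 : ℝ) 1

/-- A transcript structure for a school with ability distribution `F`: a Markov kernel from true
abilities to grades, a grade being identified with the expected ability that it reveals, i.e.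
`E[true ability | grade] = grade` under the joint law of (true ability, grade).
(As `F` lives on `[0,1]`, so do almost all grades.) -/
structure IsTranscript (F : Measure ℝ) (κ : Kernel ℝ ℝ) : Prop where
  markov : IsMarkovKernel κ
  calibrated :
    (F ⊗ₘ κ)[Prod.fst | MeasurableSpace.comap Prod.snd inferInstance] =ᵐ[F ⊗ₘ κ] Prod.snd

/-- The distribution of the grades in a school with ability distribution `F` that uses `κ`. -/
def gradeDist (F : Measure ℝ) (κ : Kernel ℝ ℝ) : Measure ℝ := (F ⊗ₘ κ).map Prod.snd

/-- When grades have the distribution `G`, a student with grade `x` occupies a rank between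
`G(x-)` and `G(x)`; `t ∈ [0,1]` is the (uniform) tie-breaker among students of equal grade. -/
def rank (G : Measure ℝ) (x t : ℝ) : ℝ := (1 - t) * G.real (Iio x) + t * G.real (Iic x)

namespace Market

variable {ι : Type*} [Fintype ι] (M : Market ι)

/-- The distribution of job qualities. -/
def jobs : Measure ℝ := (volume.restrict (Icc 0 1)).withDensity M.jobDensity

/-- The aggregate distribution of true abilities. -/
def aggregateAbility : Measure ℝ := ∑ i, M.weight i • M.ability i

/-- The quality of the job of rank `u ∈ [0,1]` (the quantile function of the job qualities). -/
def jobQuantile (u : ℝ) : ℝ := sInf {q ∈ Icc (0 : ℝ) 1 | u ≤ M.jobs.real (Iic q)}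

/-- A profile assigns a transcript structure to each type of schools. -/
def IsProfile (φ : ι → Kernel ℝ ℝ) : Prop := ∀ i, IsTranscript (M.ability i) (φ i)

/-- The aggregate distribution of expected abilities (grades) under the profile `φ`. -/
def aggregateGrade (φ : ι → Kernel ℝ ℝ) : Measure ℝ :=
  ∑ i, M.weight i • gradeDist (M.ability i) (φ i)

/-- The desirability mapping: the expected quality of the job matched with a student of grade `x`,
when higher grades are matched with better jobs. -/
def desirability (φ : ι → Kernel ℝ ℝ) (x : ℝ) : ℝ :=
  ∫ t in (0 : ℝ)..1, M.jobQuantile (rank (M.aggregateGrade φ) x t)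

/-- `φ` is an equilibrium: no school can improve the average placement of its students by another
transcript structure, the desirability mapping being kept fixed (schools are infinitesimal). -/
def IsEquilibrium (φ : ι → Kernel ℝ ℝ) : Prop :=
  M.IsProfile φ ∧ ∀ i, ∀ κ : Kernel ℝ ℝ, IsTranscript (M.ability i) κ →
    ∫ x, M.desirability φ x ∂(gradeDist (M.ability i) κ) ≤
      ∫ x, M.desirability φ x ∂(gradeDist (M.ability i) (φ i))

/-- Every point strictly between the lowest and the highest grade produced under `φ` has a
neighbourhood all of whose points are grades produced by the schools of one and the same type. -/
def IsConnected (φ : ι → Kernel ℝ ℝ) : Prop :=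
  ∀ x ∈ Ioo (sInf (M.aggregateGrade φ).support) (sSup (M.aggregateGrade φ).support),
    ∃ i, ∃ ε > 0, Ioo (x - ε) (x + ε) ⊆ (gradeDist (M.ability i) (φ i)).support

/-- The social welfare of the matching resulting from `φ`: the expected value of `f q * g a`, where
`a` is the true ability of a random student and `q` is the quality of the job he is matched with. -/
def welfare (f g : ℝ → ℝ) (φ : ι → Kernel ℝ ℝ) : ℝ :=
  ∑ i, (M.weight i : ℝ) * ∫ p, g p.1 *
      (∫ t in (0 : ℝ)..1, f (M.jobQuantile (rank (M.aggregateGrade φ) p.2 t)))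
    ∂(M.ability i ⊗ₘ φ i)

/-- The welfare of the truthful mapping, in which every school reveals the true abilities. -/
def truthfulWelfare (f g : ℝ → ℝ) : ℝ := M.welfare f g fun _ => Kernel.id

/-- The price of anarchy of the strategic grading game: the largest ratio of the welfare of the
truthful mapping to that of a connected equilibrium (the ratio is `∞` when the denominator is not
positive and the numerator is). -/
def priceOfAnarchy (f g : ℝ → ℝ) : ℝ≥0∞ :=
  ⨆ (φ : ι → Kernel ℝ ℝ) (_ : M.IsEquilibrium φ) (_ : M.IsConnected φ),
    ENNReal.ofReal (M.truthfulWelfare f g) / ENNReal.ofReal (M.welfare f g φ)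

end Market

end Grading

end

/-! Write `Q` for the desirability, `G` for the aggregate grade distribution, `q` for the job
quantile function and `b` for the highest grade. The equilibrium conditions give `Q` a convex shape,
and convexity limits how much welfare is lost.

No atoms (`IsBestResponse.gradeDist_singleton_eq_zero`): `Q` would jump at an atom, and a school
would sacrifice its few worst students there to lift the others past the jump. So `Q = q ∘ G` is
continuous. Convexity up to `b` (`IsBestResponse.two_mul_le`): a type producing all grades near `x`
cannot gain by pooling equal masses around `x - δ` and `x + δ`. Beyond `b`
(`IsBestResponse.exists_affine`): a type with students abler than `b` forces `Q` to be affine on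
some `[t, b]`. Continuing this line gives one convex `P`, the same for all types, with `∫ P dFᵢ ≤ ∫
Q dGᵢ`. Summation gives `∫₀¹ P ≤ ∫ P dG`.

The bound (`truthful_le_of_convex`): let `Φ` be the antiderivative of `P` with `Φ(1/2) = 0`; it is
convex. The truthful welfare is `∫ G(x) P(x) dG`, the equilibrium welfare is `∫ x P(x) dG`, and
their difference is at most `∫ Φ(G(x)) dG - ∫ Φ dG`. The first term is `∫₀¹ Φ ≤ 0.18 ∫₀¹ P`
(`integral_antideriv_le`). The second integral is nonnegative by Jensen, as grades have mean `1/2`.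
Finally `∫ P dG ≤ 2 ∫ x P dG` by Chebyshev's inequality, whence `1 + 2 · 0.18`. -/

namespace Grading

/-! ### Convex functions on the line. -/

/-- A continuous function that is midpoint convex at small scales around every point of `Iio h` is
convex on `Iic h`. -/
lemma convexOn_Iic_of_locally_midpoint {Q : ℝ → ℝ} (hQ : Continuous Q) {h : ℝ}
    (hloc : ∀ x < h, ∃ ε > 0, ∀ δ, 0 < δ → δ < ε → 2 * Q x ≤ Q (x - δ) + Q (x + δ)) :
    ConvexOn ℝ (Iic h) Q := by
  refine LinearOrder.convexOn_of_lt (convex_Iic h) fun y hy z hz hyz a b ha hb hab => ?_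
  simp only [smul_eq_mul]
  by_contra! hcon
  set s := (Q z - Q y) / (z - y) with hs
  have hzy : 0 < z - y := sub_pos.2 hyz
  have hsz : s * (z - y) = Q z - Q y := div_mul_cancel₀ _ hzy.ne'
  set D : ℝ → ℝ := fun x => Q x - (Q y + s * (x - y)) with hD
  have hDc : Continuous D := by fun_prop
  have hDy : D y = 0 := by simp [hD]
  have hDz : D z = 0 := by simp only [hD]; linarith
  obtain ⟨m, hm, hmax⟩ := isCompact_Icc.exists_isMaxOn (nonempty_Icc.2 hyz.le) hDc.continuousOn
  have hpos : 0 < D m := by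
    have hmem : a * y + b * z ∈ Icc y z := by
      obtain rfl : a = 1 - b := by linarith
      constructor <;> nlinarith
    have h1 : D (a * y + b * z) ≤ D m := hmax hmem
    have h2 : D (a * y + b * z) = Q (a * y + b * z) - (a * Q y + b * Q z) := by
      obtain rfl : a = 1 - b := by linarith
      simp only [hD]
      linear_combination (-b) * hsz
    linarith
  -- At the leftmost maximizer `x` of `D`, the values just to the left are strictly smaller. This
  -- contradicts the midpoint inequality, which is unaffected by subtracting the chord.
  have hne : (Icc y z ∩ D ⁻¹' {D m}).Nonempty := ⟨m, hm, rfl⟩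
  have hcl : IsClosed (Icc y z ∩ D ⁻¹' {D m}) :=
    isClosed_Icc.inter (isClosed_singleton.preimage hDc)
  have hbdd : BddBelow (Icc y z ∩ D ⁻¹' {D m}) := ⟨y, fun x hx => hx.1.1⟩
  obtain ⟨hx, hDx⟩ := hcl.csInf_mem hne hbdd
  set x := sInf (Icc y z ∩ D ⁻¹' {D m}) with hxdef
  have hDx : D x = D m := hDx
  have hyx : y < x := lt_of_le_of_ne hx.1 fun e => by rw [← e, hDy] at hDx; linarith
  have hxz : x < z := lt_of_le_of_ne hx.2 fun e => by rw [e, hDz] at hDx; linarith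
  obtain ⟨ε, hε, hmid⟩ := hloc x (hxz.trans_le hz)
  obtain ⟨δ, hδ0, hδ⟩ := exists_between (lt_min hε (lt_min (sub_pos.2 hyx) (sub_pos.2 hxz)))
  simp only [lt_min_iff] at hδ
  have h1 := hmid δ hδ0 hδ.1
  have h2 : D (x + δ) ≤ D m := hmax ⟨by linarith, by linarith⟩
  have h3 : D (x - δ) ≤ D m := hmax ⟨by linarith, by linarith⟩
  have h4 : D (x - δ) ≠ D m := fun e => by
    have : x ≤ x - δ := csInf_le hbdd ⟨⟨by linarith, by linarith⟩, e⟩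
    linarith
  have h5 := lt_of_le_of_ne h3 h4
  simp only [hD] at h2 h5 hDx
  nlinarith

/-- The function `Q` up to `t`, continued by the line through its values at `t` and `z`. -/
noncomputable def chordExtension (Q : ℝ → ℝ) (t z x : ℝ) : ℝ :=
  if x ≤ t then Q x else Q t + (Q z - Q t) / (z - t) * (x - t)

lemma chordExtension_of_le {Q : ℝ → ℝ} {t z x : ℝ} (hx : x ≤ t) :
    chordExtension Q t z x = Q x := if_pos hx

lemma chordExtension_of_ge {Q : ℝ → ℝ} {t z x : ℝ} (hx : t ≤ x) :
    chordExtension Q t z x = Q t + (Q z - Q t) / (z - t) * (x - t) := by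
  rcases hx.eq_or_lt with rfl | hx
  · simp [chordExtension]
  · exact if_neg (not_le.2 hx)

/-- By convexity of `Q`, the slope of the chord over `[t, z]` is at least every slope of `Q` ending
at or before `t`, so slopes still increase across `t`. -/
lemma convexOn_chordExtension {Q : ℝ → ℝ} {h t z : ℝ} (hQ : ConvexOn ℝ (Iic h) Q) (htz : t < z)
    (hzh : z ≤ h) : ConvexOn ℝ univ (chordExtension Q t z) := by
  set s := (Q z - Q t) / (z - t) with hs
  have hslope : ∀ x < t, (Q t - Q x) / (t - x) ≤ s := fun x hx =>
    hQ.slope_mono_adjacent (mem_Iic.2 (by linarith)) (mem_Iic.2 hzh) hx htz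
  refine convexOn_of_slope_mono_adjacent convex_univ fun {x y w} _ _ hxy hyw => ?_
  rcases le_or_gt y t with hyt | hyt
  · rw [chordExtension_of_le hyt, chordExtension_of_le (hxy.le.trans hyt)]
    rcases le_or_gt w t with hwt | hwt
    · rw [chordExtension_of_le hwt]
      exact hQ.slope_mono_adjacent (mem_Iic.2 (by linarith)) (mem_Iic.2 (by linarith)) hxy hyw
    · rw [chordExtension_of_ge hwt.le, ← hs]
      set m := (Q y - Q x) / (y - x) with hm
      rw [le_div_iff₀ (sub_pos.2 hyw)]
      have hms : m ≤ s ∧ m * (t - y) ≤ Q t - Q y := by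
        rcases hyt.eq_or_lt with rfl | hyt
        · exact ⟨hslope x hxy, by simp⟩
        · have h1 : m ≤ (Q t - Q y) / (t - y) :=
            hQ.slope_mono_adjacent (mem_Iic.2 (by linarith)) (mem_Iic.2 (by linarith)) hxy hyt
          exact ⟨h1.trans (hslope y hyt), (le_div_iff₀ (sub_pos.2 hyt)).1 h1⟩
      nlinarith [hms.1, hms.2, sub_pos.2 hwt]
  · rw [chordExtension_of_ge hyt.le, chordExtension_of_ge (hyt.le.trans hyw.le), ← hs]
    have h1 : (Q t + s * (w - t) - (Q t + s * (y - t))) / (w - y) = s := by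
      field_simp [(sub_pos.2 hyw).ne']
      ring
    rw [h1, div_le_iff₀ (sub_pos.2 hxy)]
    rcases le_or_gt x t with hxt | hxt
    · rw [chordExtension_of_le hxt]
      rcases hxt.eq_or_lt with rfl | hxt
      · linarith
      · have := (div_le_iff₀ (sub_pos.2 hxt)).1 (hslope x hxt)
        linarith
    · rw [chordExtension_of_ge hxt.le, ← hs]
      linarith

lemma continuous_chordExtension {Q : ℝ → ℝ} (hQ : Continuous Q) (t z : ℝ) :
    Continuous (chordExtension Q t z) :=
  Continuous.if_le hQ (by fun_prop) continuous_id continuous_const fun x hx => by simp [hx]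

lemma monotone_chordExtension {Q : ℝ → ℝ} (hQ : Monotone Q) {t z : ℝ} (htz : t < z) :
    Monotone (chordExtension Q t z) := by
  have hs : 0 ≤ (Q z - Q t) / (z - t) :=
    div_nonneg (sub_nonneg.2 (hQ htz.le)) (sub_nonneg.2 htz.le)
  intro x y hxy
  rcases le_or_gt y t with hy | hy
  · rw [chordExtension_of_le hy, chordExtension_of_le (hxy.trans hy)]
    exact hQ hxy
  · rw [chordExtension_of_ge hy.le]
    rcases le_or_gt x t with hx | hx
    · rw [chordExtension_of_le hx]
      have := hQ hx
      nlinarith [sub_pos.2 hy]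
    · rw [chordExtension_of_ge hx.le]
      nlinarith

/-- For a nonnegative convex `P` the mean over `[0, 1]` of its antiderivative vanishing at `1/2` is
at most `0.18` times the mean of `P`. -/
lemma integral_antideriv_le {P : ℝ → ℝ} (hc : Continuous P) (h0 : ∀ x ∈ Icc (0 : ℝ) 1, 0 ≤ P x)
    (hmono : Monotone P) (hP : ConvexOn ℝ (Icc 0 1) P) :
    ∫ u in (0 : ℝ)..1, ∫ x in (1 / 2 : ℝ)..u, P x ≤ 0.18 * ∫ x in (0 : ℝ)..1, P x := by
  set Φ : ℝ → ℝ := fun u => ∫ x in (1 / 2 : ℝ)..u, P x with hΦ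
  have hd : ∀ u, HasDerivAt Φ (P u) u := fun u =>
    intervalIntegral.integral_hasDerivAt_right (hc.intervalIntegrable _ _)
      hc.aestronglyMeasurable.stronglyMeasurableAtFilter hc.continuousAt
  have hΦc : Continuous Φ := continuous_iff_continuousAt.2 fun u => (hd u).continuousAt
  have hparts : ∀ a b d : ℝ, ∫ u in a..b, Φ u
      = (b - d) * Φ b - (a - d) * Φ a - ∫ u in a..b, (u - d) * P u := fun a b d => by
    have := intervalIntegral.integral_mul_deriv_eq_deriv_mul (a := a) (b := b)
      (u := fun u => u - d) (u' := fun _ => 1) (v := Φ) (v' := P)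
      (fun x _ => (hasDerivAt_id x).sub_const d) (fun x _ => hd x)
      (by simp) (hc.intervalIntegrable _ _)
    simp only [one_mul] at this
    linarith
  have hhalf : Φ (1 / 2) = 0 := by simp [hΦ]
  have hi : ∀ f : ℝ → ℝ, Continuous f → ∀ a b, IntervalIntegrable f volume a b :=
    fun f hf a b => hf.intervalIntegrable a b
  -- After integration by parts the claim is `∫ (0.82 - x) P` over `[1/2, 1]` at most `∫ (x + 0.18)
  -- P` over `[0, 1/2]`. The first weight changes sign at `0.82`, so the line through the values of
  -- `P` at `1/2` and `0.82` lies on the favourable side of `P` everywhere.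
  set r := P (1 / 2) with hr
  set c := (P 0.82 - P (1 / 2)) / (0.82 - 1 / 2) with hcdef
  have hr0 : 0 ≤ r := h0 _ ⟨by norm_num, by norm_num⟩
  have hc0 : 0 ≤ c := div_nonneg (sub_nonneg.2 (hmono (by norm_num))) (by norm_num)
  have hc82 : P 0.82 = r + c * 0.32 := by simp only [hcdef, hr]; ring
  have hin : ∀ x ∈ Icc (1 / 2 : ℝ) 0.82, P x ≤ r + c * (x - 1 / 2) := by
    intro x hx
    have := hP.2 (show (1 / 2 : ℝ) ∈ Icc 0 1 from ⟨by norm_num, by norm_num⟩)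
      (show (0.82 : ℝ) ∈ Icc 0 1 from ⟨by norm_num, by norm_num⟩)
      (show 0 ≤ (0.82 - x) / 0.32 from div_nonneg (by linarith [hx.2]) (by norm_num))
      (show 0 ≤ (x - 1 / 2) / 0.32 from div_nonneg (by linarith [hx.1]) (by norm_num)) (by ring)
    simp only [smul_eq_mul] at this
    have e : (0.82 - x) / 0.32 * (1 / 2) + (x - 1 / 2) / 0.32 * 0.82 = x := by ring
    rw [e, hc82, ← hr] at this
    have e' : (0.82 - x) / 0.32 * r + (x - 1 / 2) / 0.32 * (r + c * 0.32) = r + c * (x - 1 / 2) := by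
      ring
    linarith
  have hout : ∀ x ∈ Icc (0 : ℝ) (1 / 2), r + c * (x - 1 / 2) ≤ P x := by
    intro x hx
    rcases hx.2.eq_or_lt with rfl | h2
    · simp [hr]
    · have := hP.slope_mono_adjacent (x := x) (y := 1 / 2) (z := 0.82)
        ⟨hx.1, by linarith⟩ ⟨by norm_num, by norm_num⟩ h2 (by norm_num)
      rw [div_le_iff₀ (by linarith), ← hcdef] at this
      linarith
  have hout' : ∀ x ∈ Icc (0.82 : ℝ) 1, r + c * (x - 1 / 2) ≤ P x := by
    intro x hx
    rcases hx.1.eq_or_lt with rfl | h2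
    · rw [hc82]; linarith
    · have := hP.slope_mono_adjacent (x := 1 / 2) (y := 0.82) (z := x)
        ⟨by norm_num, by norm_num⟩ ⟨by linarith [hx.1], hx.2⟩ (by norm_num) h2
      rw [le_div_iff₀ (by linarith)] at this
      rw [← hcdef] at this
      linarith
  have hright : ∫ x in (1 / 2 : ℝ)..1, (0.82 - x) * P x
      ≤ ∫ x in (1 / 2 : ℝ)..1, (0.82 - x) * (r + c * (x - 1 / 2)) := by
    refine intervalIntegral.integral_mono_on (by norm_num) (hi _ (by fun_prop) _ _)
      (hi _ (by fun_prop) _ _) fun x hx => ?_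
    rcases le_total x 0.82 with hx2 | hx2
    · exact mul_le_mul_of_nonneg_left (hin x ⟨hx.1, hx2⟩) (by linarith)
    · exact mul_le_mul_of_nonpos_left (hout' x ⟨hx2, hx.2⟩) (by linarith)
  have hleft : ∫ x in (0.44 : ℝ)..(1 / 2), (x + 0.18) * (r + c * (x - 1 / 2))
      ≤ ∫ x in (0.44 : ℝ)..(1 / 2), (x + 0.18) * P x := by
    refine intervalIntegral.integral_mono_on (by norm_num) (hi _ (by fun_prop) _ _)
      (hi _ (by fun_prop) _ _) fun x hx => ?_
    exact mul_le_mul_of_nonneg_left (hout x ⟨by linarith [hx.1], hx.2⟩) (by linarith [hx.1])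
  -- The line may become negative far to the left, so on `[0, 0.44]` only `P ≥ 0` is used. With this
  -- cut the coefficients of `r` and `c` compare separately: `0.035 ≤ 0.038` and `0.00116 ≤ 1/600`.
  have hzero : 0 ≤ ∫ x in (0 : ℝ)..0.44, (x + 0.18) * P x :=
    intervalIntegral.integral_nonneg (by norm_num) fun x hx =>
      mul_nonneg (by linarith [hx.1]) (h0 x ⟨hx.1, by linarith [hx.2]⟩)
  have hsplit : ∫ x in (0 : ℝ)..(1 / 2), (x + 0.18) * P x
      = (∫ x in (0 : ℝ)..0.44, (x + 0.18) * P x) + ∫ x in (0.44 : ℝ)..(1 / 2), (x + 0.18) * P x :=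
    (intervalIntegral.integral_add_adjacent_intervals (hi _ (by fun_prop) _ _)
      (hi _ (by fun_prop) _ _)).symm
  have e1 : ∫ x in (1 / 2 : ℝ)..1, (0.82 - x) * (r + c * (x - 1 / 2))
      = r * 0.035 - c * (1 / 600) := by
    have : ∀ x : ℝ, (0.82 - x) * (r + c * (x - 1 / 2))
        = (0.82 * (r - c / 2)) + (0.82 * c - (r - c / 2)) * x ^ 1 - c * x ^ 2 := fun x => by ring
    simp only [this]
    rw [intervalIntegral.integral_sub (hi _ (by fun_prop) _ _) (hi _ (by fun_prop) _ _),
      intervalIntegral.integral_add (hi _ (by fun_prop) _ _) (hi _ (by fun_prop) _ _)]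
    simp only [intervalIntegral.integral_const, intervalIntegral.integral_const_mul, integral_pow,
      smul_eq_mul]
    norm_num
    ring
  have e2 : r * 0.038 - c * 0.00116 ≤
      ∫ x in (0.44 : ℝ)..(1 / 2), (x + 0.18) * (r + c * (x - 1 / 2)) := by
    have : ∀ x : ℝ, (x + 0.18) * (r + c * (x - 1 / 2))
        = (0.18 * (r - c / 2)) + (0.18 * c + (r - c / 2)) * x ^ 1 + c * x ^ 2 := fun x => by ring
    simp only [this]
    rw [intervalIntegral.integral_add (hi _ (by fun_prop) _ _) (hi _ (by fun_prop) _ _),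
      intervalIntegral.integral_add (hi _ (by fun_prop) _ _) (hi _ (by fun_prop) _ _)]
    simp only [intervalIntegral.integral_const, intervalIntegral.integral_const_mul, integral_pow,
      smul_eq_mul]
    norm_num
    linarith
  have hA := hparts 0 (1 / 2) 0
  have hB := hparts (1 / 2) 1 1
  have hadd : ∫ u in (0 : ℝ)..1, Φ u
      = (∫ u in (0 : ℝ)..(1 / 2), Φ u) + ∫ u in (1 / 2 : ℝ)..1, Φ u :=
    (intervalIntegral.integral_add_adjacent_intervals (hi _ hΦc _ _) (hi _ hΦc _ _)).symm
  have haddP : ∫ u in (0 : ℝ)..1, P u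
      = (∫ u in (0 : ℝ)..(1 / 2), P u) + ∫ u in (1 / 2 : ℝ)..1, P u :=
    (intervalIntegral.integral_add_adjacent_intervals (hi _ hc _ _) (hi _ hc _ _)).symm
  have e3 : ∫ x in (0 : ℝ)..(1 / 2), (x + 0.18) * P x
      = (∫ x in (0 : ℝ)..(1 / 2), (x - 0) * P x) + 0.18 * ∫ x in (0 : ℝ)..(1 / 2), P x := by
    rw [← intervalIntegral.integral_const_mul,
      ← intervalIntegral.integral_add (hi _ (by fun_prop) _ _) (hi _ (by fun_prop) _ _)]
    exact intervalIntegral.integral_congr fun x _ => by ring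
  have e4 : ∫ x in (1 / 2 : ℝ)..1, (0.82 - x) * P x
      = -(∫ x in (1 / 2 : ℝ)..1, (x - 1) * P x) - 0.18 * ∫ x in (1 / 2 : ℝ)..1, P x := by
    rw [← intervalIntegral.integral_const_mul, ← intervalIntegral.integral_neg,
      ← intervalIntegral.integral_sub (hi _ (by fun_prop) _ _) (hi _ (by fun_prop) _ _)]
    exact intervalIntegral.integral_congr fun x _ => by ring
  simp only [hhalf, mul_zero, sub_self, zero_mul, sub_zero, zero_sub] at hA hB
  simp only [sub_zero] at e3
  linarith

end Grading

/-! ### Atomless distributions and the welfare inequality. -/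

namespace Grading

open Filter Topology

lemma coe_cdf_eq (G : Measure ℝ) [IsProbabilityMeasure G] :
    (cdf G : ℝ → ℝ) = fun x => G.real (Iic x) := by
  ext x
  rw [cdf_eq_real]

lemma continuous_real_Iic (G : Measure ℝ) [IsProbabilityMeasure G] [NullSingletonClass G] :
    Continuous fun x => G.real (Iic x) := by
  rw [← coe_cdf_eq]
  refine continuous_iff_continuousAt.2 fun x => ?_
  rw [(monotone_cdf G).continuousAt_iff_leftLim_eq_rightLim, StieltjesFunction.rightLim_eq]
  have h2 := (cdf G).measure_singleton x
  rw [measure_cdf, measure_singleton] at h2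
  have h3 := (monotone_cdf G).leftLim_le (le_refl x)
  have h4 := ENNReal.ofReal_eq_zero.1 h2.symm
  linarith

/-- The probability integral transform. -/
lemma map_real_Iic_eq_uniform (G : Measure ℝ) [IsProbabilityMeasure G] [NullSingletonClass G] :
    G.map (fun x => G.real (Iic x)) = volume.restrict (Icc 0 1) := by
  have hc := continuous_real_Iic G
  have hmono : Monotone fun x => G.real (Iic x) := fun x y hxy =>
    measureReal_mono (Iic_subset_Iic.2 hxy)
  have hprob := Measure.isProbabilityMeasure_map (μ := G) hc.aemeasurable
  have hiv : ∀ u ∈ Ioo (0 : ℝ) 1, ∃ y, G.real (Iic y) = u := fun u hu => by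
    have hbot : Tendsto (fun x => G.real (Iic x)) atBot (𝓝 0) :=
      coe_cdf_eq G ▸ tendsto_cdf_atBot G
    have htop : Tendsto (fun x => G.real (Iic x)) atTop (𝓝 1) :=
      coe_cdf_eq G ▸ tendsto_cdf_atTop G
    obtain ⟨a, ha⟩ := (hbot.eventually (gt_mem_nhds hu.1)).exists
    obtain ⟨b, hb⟩ := (htop.eventually (lt_mem_nhds hu.2)).exists
    exact mem_range_of_exists_le_of_exists_ge hc ⟨a, ha.le⟩ ⟨b, hb.le⟩
  refine Measure.ext_of_Iic _ _ fun u => ?_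
  rw [Measure.map_apply hc.measurable measurableSet_Iic,
    Measure.restrict_apply measurableSet_Iic]
  rcases lt_or_ge u 0 with hu0 | hu0
  · have h1 : (fun x => G.real (Iic x)) ⁻¹' Iic u = ∅ :=
      eq_empty_of_forall_notMem fun x hx => (hu0.trans_le measureReal_nonneg).not_ge hx
    have h2 : Iic u ∩ Icc 0 1 = ∅ :=
      eq_empty_of_forall_notMem fun x hx => (hu0.trans_le hx.2.1).not_ge hx.1
    rw [h1, h2, measure_empty, measure_empty]
  rcases le_or_gt 1 u with hu1 | hu1
  · have h1 : (fun x => G.real (Iic x)) ⁻¹' Iic u = univ :=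
      eq_univ_of_forall fun x => mem_preimage.2 (measureReal_le_one.trans hu1)
    have h2 : Iic u ∩ Icc 0 1 = Icc 0 1 :=
      inter_eq_right.2 fun x hx => hx.2.trans hu1
    rw [h1, h2, measure_univ]
    simp
  have h2 : Iic u ∩ Icc 0 1 = Icc 0 u := by
    ext x
    simp only [mem_inter_iff, mem_Iic, mem_Icc]
    exact ⟨fun h => ⟨h.2.1, h.1⟩, fun h => ⟨h.2, h.1, h.2.trans hu1.le⟩⟩
  rw [h2, Real.volume_Icc, sub_zero, ← ENNReal.ofReal_toReal (measure_ne_top G _)]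
  congr 1
  apply le_antisymm
  -- The distribution function may be flat at level `u`, so the upper bound goes through levels `v >
  -- u`. In the lower bound, level `0` is separate because it need not be attained.
  · refine le_of_forall_gt_imp_ge_of_dense fun v hv => ?_
    rcases le_or_gt 1 v with hv1 | hv1
    · exact measureReal_le_one.trans hv1
    obtain ⟨y, hy⟩ := hiv v ⟨hu0.trans_lt hv, hv1⟩
    rw [← hy]
    refine measureReal_mono fun x hx => ?_
    by_contra hxy
    have := hmono (not_le.1 hxy).le
    simp only [mem_preimage, mem_Iic] at hx this
    linarith
  · rcases hu0.eq_or_lt with rfl | hu0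
    · exact measureReal_nonneg
    obtain ⟨y, hy⟩ := hiv u ⟨hu0, hu1⟩
    conv_lhs => rw [← hy]
    exact measureReal_mono fun x hx => (hmono hx).trans hy.le

/-- Without atoms the mass of `Ioc l b` is continuous in `b`. This cuts out groups of students of
prescribed mass. -/
lemma exists_measureReal_Ioc_eq (G : Measure ℝ) [IsFiniteMeasure G] [NullSingletonClass G]
    {l r m : ℝ} (hlr : l ≤ r) (hm : 0 ≤ m) (hmr : m ≤ G.real (Ioc l r)) :
    ∃ b ∈ Icc l r, G.real (Ioc l b) = m := by
  have hcont : Continuous fun b => ∫ _ in l..b, (1 : ℝ) ∂G :=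
    intervalIntegral.continuous_primitive (fun a b => intervalIntegrable_const) l
  have hval : ∀ b, l ≤ b → ∫ _ in l..b, (1 : ℝ) ∂G = G.real (Ioc l b) := fun b hb => by
    rw [intervalIntegral.integral_of_le hb, setIntegral_const, smul_eq_mul, mul_one]
  obtain ⟨b, hb, hbm⟩ := intermediate_value_Icc hlr hcont.continuousOn
    (show m ∈ Icc _ _ by
      simp only [intervalIntegral.integral_same, hval r hlr]
      exact ⟨hm, hmr⟩)
  exact ⟨b, hb, by rw [← hval b hb.1]; exact hbm⟩

lemma integral_comp_real_Iic (G : Measure ℝ) [IsProbabilityMeasure G] [NullSingletonClass G] {f : ℝ → ℝ}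
    (hf : ContinuousOn f (Icc 0 1)) :
    ∫ x, f (G.real (Iic x)) ∂G = ∫ u in (0 : ℝ)..1, f u := by
  rw [intervalIntegral.integral_of_le zero_le_one, ← integral_Icc_eq_integral_Ioc,
    ← map_real_Iic_eq_uniform G, integral_map (continuous_real_Iic G).aemeasurable]
  rw [map_real_Iic_eq_uniform G]
  exact hf.aestronglyMeasurable measurableSet_Icc

lemma integrable_of_continuous_of_mem_Icc {α : Type*} [MeasurableSpace α] {μ : Measure α}
    [IsFiniteMeasure μ] {g : α → ℝ} (hg : Measurable g) (hI : ∀ᵐ x ∂μ, g x ∈ Icc (0 : ℝ) 1)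
    {f : ℝ → ℝ} (hf : Continuous f) : Integrable (fun x => f (g x)) μ := by
  obtain ⟨C, hC⟩ := (isCompact_Icc (a := (0 : ℝ)) (b := 1)).exists_bound_of_continuousOn
    hf.continuousOn
  exact Integrable.of_bound (hf.measurable.comp hg).aestronglyMeasurable C
    (hI.mono fun x hx => hC _ hx)

/-- The tangent-line inequality for the convex antiderivative of `P`, on either side of `a`. -/
lemma mul_sub_le_integral_of_monotone {P : ℝ → ℝ} (hc : Continuous P) (hP : Monotone P)
    (a b : ℝ) : P a * (b - a) ≤ ∫ x in a..b, P x := by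
  rcases le_total a b with h | h
  · calc P a * (b - a) = ∫ _ in a..b, P a := by simp [mul_comm]
      _ ≤ _ := intervalIntegral.integral_mono_on h (by simp) (hc.intervalIntegrable _ _)
          fun x hx => hP hx.1
  · rw [intervalIntegral.integral_symm]
    have : ∫ x in b..a, P x ≤ ∫ _ in b..a, P a :=
      intervalIntegral.integral_mono_on h (hc.intervalIntegrable _ _) (by simp)
        fun x hx => hP hx.2
    simp at this
    linarith

/-- If grades with mean `1/2` receive jobs according to their rank, the resulting placement extends
to a convex function `P`, and revealing uniform abilities against `P` is not an improvement, then
the welfare is within a factor `1.36` of that of the truthful matching. -/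
lemma truthful_le_of_convex (G : Measure ℝ) [IsProbabilityMeasure G] [NullSingletonClass G]
    (hG : ∀ᵐ x ∂G, x ∈ Icc (0 : ℝ) 1) (hmean : ∫ x, x ∂G = 1 / 2) {q P : ℝ → ℝ}
    (hq : ContinuousOn q (Icc 0 1)) (hc : Continuous P) (hmono : Monotone P)
    (h0 : ∀ x ∈ Icc (0 : ℝ) 1, 0 ≤ P x) (hconv : ConvexOn ℝ (Icc 0 1) P)
    (hPq : ∀ᵐ x ∂G, P x = q (G.real (Iic x)))
    (hint : ∫ x in (0 : ℝ)..1, P x ≤ ∫ x, P x ∂G) :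
    ∫ u in (0 : ℝ)..1, u * q u ≤ 1.36 * ∫ x, x * P x ∂G := by
  set c : ℝ → ℝ := fun x => G.real (Iic x) with hcdef
  have hcc : Continuous c := continuous_real_Iic G
  set Φ : ℝ → ℝ := fun u => ∫ x in (1 / 2 : ℝ)..u, P x with hΦ
  have hΦc : Continuous Φ := intervalIntegral.continuous_primitive
    (fun a b => hc.intervalIntegrable a b) _
  have hΦsub : ∀ a b, Φ b - Φ a = ∫ x in a..b, P x := fun a b =>
    intervalIntegral.integral_interval_sub_left (hc.intervalIntegrable _ _)
      (hc.intervalIntegrable _ _)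
  have iI : ∀ f : ℝ → ℝ, Continuous f → Integrable f G := fun f hf =>
    integrable_of_continuous_of_mem_Icc measurable_id hG hf
  -- Ranks are uniformly distributed under `G`, so `u = c x` is a change of variables.
  have e1 : ∫ u in (0 : ℝ)..1, u * q u = ∫ x, c x * P x ∂G := by
    rw [← integral_comp_real_Iic G (f := fun u => u * q u) (continuousOn_id.mul hq)]
    refine integral_congr_ae ?_
    filter_upwards [hPq] with x hx
    simp [hx, hcdef]
  have e2 : ∫ x, Φ (c x) ∂G = ∫ u in (0 : ℝ)..1, Φ u :=
    integral_comp_real_Iic G hΦc.continuousOn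
  -- The tangent to `Φ` at the grade `x`, evaluated at the rank `c x`.
  have h1 : ∫ x, c x * P x ∂G - ∫ x, x * P x ∂G ≤ ∫ x, Φ (c x) ∂G - ∫ x, Φ x ∂G := by
    rw [← integral_sub (iI _ (by fun_prop)) (iI _ (by fun_prop)),
      ← integral_sub (iI _ (by fun_prop)) (iI _ (by fun_prop))]
    refine integral_mono (iI _ (by fun_prop)) (iI _ (by fun_prop)) fun x => ?_
    have := mul_sub_le_integral_of_monotone hc hmono x (c x)
    rw [← hΦsub] at this
    simp only
    linarith
  have hcent : ∫ x, (x - 1 / 2) ∂G = 0 := by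
    rw [integral_sub (f := fun x => x) (iI _ continuous_id) (iI _ continuous_const), hmean]
    simp
  have h2 : 0 ≤ ∫ x, Φ x ∂G := by
    have : ∫ x, P (1 / 2) * (x - 1 / 2) ∂G ≤ ∫ x, Φ x ∂G :=
      integral_mono (iI _ (by fun_prop)) (iI _ hΦc) fun x =>
        mul_sub_le_integral_of_monotone hc hmono (1 / 2) x
    rwa [integral_const_mul, hcent, mul_zero] at this
  have h3 := integral_antideriv_le hc h0 hmono hconv
  -- Chebyshev: `x - 1/2` and `P x - P (1/2)` have the same sign.
  have h4 : 1 / 2 * ∫ x, P x ∂G ≤ ∫ x, x * P x ∂G := by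
    have : 0 ≤ ∫ x, (x - 1 / 2) * (P x - P (1 / 2)) ∂G := integral_nonneg fun x => by
      rcases le_total x (1 / 2) with hx | hx
      · exact mul_nonneg_of_nonpos_of_nonpos (by linarith) (sub_nonpos.2 (hmono hx))
      · exact mul_nonneg (by linarith) (sub_nonneg.2 (hmono hx))
    have e : ∫ x, (x - 1 / 2) * (P x - P (1 / 2)) ∂G
        = ∫ x, (x * P x - 1 / 2 * P x) ∂G - ∫ x, P (1 / 2) * (x - 1 / 2) ∂G := by
      rw [← integral_sub (iI _ (by fun_prop)) (iI _ (by fun_prop))]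
      congr 1
      ext x
      ring
    rw [e, integral_const_mul, hcent, integral_sub (iI _ (by fun_prop)) (iI _ (by fun_prop)),
      integral_const_mul] at this
    linarith
  rw [e1]
  linarith

end Grading

/-! ### Calibration of transcript structures, and regrading. -/

namespace Grading

lemma ae_compProd_fst_mem_Icc {F : Measure ℝ} (κ : Kernel ℝ ℝ)
    (hF : ∀ᵐ a ∂F, a ∈ Icc (0 : ℝ) 1) : ∀ᵐ p ∂(F ⊗ₘ κ), p.1 ∈ Icc (0 : ℝ) 1 :=
  Measure.ae_compProd_of_ae_fst κ measurableSet_Icc hF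

lemma integrable_fst_compProd {F : Measure ℝ} [IsProbabilityMeasure F] {κ : Kernel ℝ ℝ}
    [IsMarkovKernel κ] (hF : ∀ᵐ a ∂F, a ∈ Icc (0 : ℝ) 1) :
    Integrable (fun p : ℝ × ℝ => p.1) (F ⊗ₘ κ) :=
  integrable_of_continuous_of_mem_Icc measurable_fst (ae_compProd_fst_mem_Icc κ hF) continuous_id

namespace IsTranscript

variable {F : Measure ℝ} [IsProbabilityMeasure F] {κ : Kernel ℝ ℝ}

lemma ae_snd_mem_Icc (hκ : IsTranscript F κ) (hF : ∀ᵐ a ∂F, a ∈ Icc (0 : ℝ) 1) :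
    ∀ᵐ p ∂(F ⊗ₘ κ), p.2 ∈ Icc (0 : ℝ) 1 := by
  have := hκ.markov
  have hle : MeasurableSpace.comap (Prod.snd : ℝ × ℝ → ℝ) inferInstance
      ≤ (inferInstance : MeasurableSpace (ℝ × ℝ)) := measurable_snd.comap_le
  have h0 := condExp_mono (m := MeasurableSpace.comap (Prod.snd : ℝ × ℝ → ℝ) inferInstance)
    (integrable_const (μ := F ⊗ₘ κ) (0 : ℝ)) (integrable_fst_compProd hF)
    ((ae_compProd_fst_mem_Icc κ hF).mono fun p hp => hp.1)
  have h1 := condExp_mono (m := MeasurableSpace.comap (Prod.snd : ℝ × ℝ → ℝ) inferInstance)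
    (integrable_fst_compProd hF) (integrable_const (μ := F ⊗ₘ κ) (1 : ℝ))
    ((ae_compProd_fst_mem_Icc κ hF).mono fun p hp => hp.2)
  rw [condExp_const hle] at h0 h1
  filter_upwards [h0, h1, hκ.calibrated] with p hp0 hp1 hp
  have hp' : (F ⊗ₘ κ)[fun p : ℝ × ℝ => p.1 |
    MeasurableSpace.comap Prod.snd inferInstance] p = p.2 := hp
  rw [hp'] at hp0 hp1
  exact ⟨hp0, hp1⟩

/-- Bounded functions of the grade can be pulled out of the conditional expectation of the ability.
-/
lemma integral_mul_fst (hκ : IsTranscript F κ) (hF : ∀ᵐ a ∂F, a ∈ Icc (0 : ℝ) 1) {ψ : ℝ → ℝ}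
    (hψ : Measurable ψ) {C : ℝ} (hC : ∀ x, |ψ x| ≤ C) :
    ∫ p, ψ p.2 * p.1 ∂(F ⊗ₘ κ) = ∫ p, ψ p.2 * p.2 ∂(F ⊗ₘ κ) := by
  have := hκ.markov
  have hle : MeasurableSpace.comap (Prod.snd : ℝ × ℝ → ℝ) inferInstance
      ≤ (inferInstance : MeasurableSpace (ℝ × ℝ)) := measurable_snd.comap_le
  have hm : StronglyMeasurable[MeasurableSpace.comap (Prod.snd : ℝ × ℝ → ℝ) inferInstance]
      fun p : ℝ × ℝ => ψ p.2 :=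
    (hψ.comp (comap_measurable Prod.snd)).stronglyMeasurable
  have h := condExp_stronglyMeasurable_mul_of_bound (μ := F ⊗ₘ κ) hle hm
    (integrable_fst_compProd hF) C (ae_of_all _ fun p => hC p.2)
  calc ∫ p, ψ p.2 * p.1 ∂(F ⊗ₘ κ)
      = ∫ p, ((fun p : ℝ × ℝ => ψ p.2) * fun p : ℝ × ℝ => p.1) p ∂(F ⊗ₘ κ) := rfl
    _ = _ := (integral_condExp hle).symm
    _ = ∫ p, ψ p.2 * p.2 ∂(F ⊗ₘ κ) := by
      refine integral_congr_ae (h.trans ?_)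
      filter_upwards [hκ.calibrated] with p hp
      exact congrArg (ψ p.2 * ·) hp

lemma setIntegral_fst (hκ : IsTranscript F κ) (hF : ∀ᵐ a ∂F, a ∈ Icc (0 : ℝ) 1) {B : Set ℝ}
    (hB : MeasurableSet B) :
    ∫ p in Prod.snd ⁻¹' B, p.1 ∂(F ⊗ₘ κ) = ∫ p in Prod.snd ⁻¹' B, p.2 ∂(F ⊗ₘ κ) := by
  have h := hκ.integral_mul_fst hF (ψ := B.indicator 1) (measurable_one.indicator hB) (C := 1)
    fun x => by by_cases hx : x ∈ B <;> simp [hx]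
  rw [← integral_indicator (measurable_snd hB), ← integral_indicator (measurable_snd hB)]
  convert h using 2 with p <;> ext p <;> by_cases hp : p.2 ∈ B <;> simp [hp]

/-- Jensen's inequality: for a convex valuation of grades, full revelation is at least as good as
any transcript structure. -/
lemma integral_comp_snd_le (hκ : IsTranscript F κ) (hF : ∀ᵐ a ∂F, a ∈ Icc (0 : ℝ) 1)
    {R : ℝ → ℝ} (hR : ConvexOn ℝ univ R) (hc : Continuous R) :
    ∫ p, R p.2 ∂(F ⊗ₘ κ) ≤ ∫ a, R a ∂F := by
  have := hκ.markov
  have hle : MeasurableSpace.comap (Prod.snd : ℝ × ℝ → ℝ) inferInstance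
      ≤ (inferInstance : MeasurableSpace (ℝ × ℝ)) := measurable_snd.comap_le
  have hRi : Integrable (fun p : ℝ × ℝ => R p.1) (F ⊗ₘ κ) :=
    integrable_of_continuous_of_mem_Icc measurable_fst (ae_compProd_fst_mem_Icc κ hF) hc
  have h := hR.map_condExp_le_univ (μ := F ⊗ₘ κ) hle hc.lowerSemicontinuous
    (integrable_fst_compProd hF) hRi
  calc ∫ p, R p.2 ∂(F ⊗ₘ κ)
      ≤ ∫ p, ((F ⊗ₘ κ)[fun p : ℝ × ℝ => R p.1 |
          MeasurableSpace.comap Prod.snd inferInstance]) p ∂(F ⊗ₘ κ) := by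
        refine integral_mono_ae
          (integrable_of_continuous_of_mem_Icc measurable_snd (hκ.ae_snd_mem_Icc hF) hc)
          integrable_condExp ?_
        filter_upwards [h, hκ.calibrated] with p hp hp2
        have hp' : (F ⊗ₘ κ)[fun p : ℝ × ℝ => p.1 |
          MeasurableSpace.comap Prod.snd inferInstance] p = p.2 := hp2
        simp only [Function.comp_def, hp'] at hp
        exact hp
    _ = ∫ p, R p.1 ∂(F ⊗ₘ κ) := integral_condExp hle
    _ = ∫ a, R a ∂((F ⊗ₘ κ).map Prod.fst) :=
        (integral_map measurable_fst.aemeasurable hc.aestronglyMeasurable).symm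
    _ = ∫ a, R a ∂F := by
        have : (F ⊗ₘ κ).map Prod.fst = F := Measure.fst_compProd F κ
        rw [this]

end IsTranscript

/-- `Kernel.id ×ₖ κ` keeps the ability beside the drawn grade, so the new grade may depend on both.
-/
lemma compProd_map_id_prod (F : Measure ℝ) [IsProbabilityMeasure F] (κ : Kernel ℝ ℝ)
    [IsMarkovKernel κ] {T : ℝ × ℝ → ℝ} (hT : Measurable T) :
    F ⊗ₘ ((Kernel.id ×ₖ κ).map T) = (F ⊗ₘ κ).map fun p => (p.1, T p) := by
  have : IsMarkovKernel ((Kernel.id ×ₖ κ).map T) := Kernel.IsMarkovKernel.map _ hT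
  have hS : Measurable fun p : ℝ × ℝ => (p.1, T p) := by fun_prop
  ext s hs
  rw [Measure.compProd_apply hs, Measure.map_apply hS hs, Measure.compProd_apply (hS hs)]
  refine lintegral_congr fun a => ?_
  rw [Kernel.map_apply' _ hT _ (measurable_prodMk_left hs), Kernel.prod_apply, Kernel.id_apply,
    Measure.dirac_prod, Measure.map_apply measurable_prodMk_left
      (hT (measurable_prodMk_left hs))]
  rfl

/-- Regrading: a new grade may be any function `T` of ability and old grade that is calibrated. -/
lemma exists_transcript_of_regrading {F : Measure ℝ} [IsProbabilityMeasure F] {κ : Kernel ℝ ℝ}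
    [IsMarkovKernel κ] (hF : ∀ᵐ a ∂F, a ∈ Icc (0 : ℝ) 1) {T : ℝ × ℝ → ℝ} (hT : Measurable T)
    (hTi : Integrable T (F ⊗ₘ κ))
    (hcal : ∀ C, MeasurableSet C →
      ∫ p in T ⁻¹' C, T p ∂(F ⊗ₘ κ) = ∫ p in T ⁻¹' C, p.1 ∂(F ⊗ₘ κ)) :
    ∃ κ', IsTranscript F κ' ∧ gradeDist F κ' = (F ⊗ₘ κ).map T := by
  have : IsMarkovKernel ((Kernel.id ×ₖ κ).map T) := Kernel.IsMarkovKernel.map _ hT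
  have hS : Measurable fun p : ℝ × ℝ => (p.1, T p) := by fun_prop
  have hmap := compProd_map_id_prod F κ hT
  have hle : MeasurableSpace.comap (Prod.snd : ℝ × ℝ → ℝ) inferInstance
      ≤ (inferInstance : MeasurableSpace (ℝ × ℝ)) := measurable_snd.comap_le
  have hsnd : Integrable (fun p : ℝ × ℝ => p.2) (F ⊗ₘ ((Kernel.id ×ₖ κ).map T)) := by
    rw [hmap, integrable_map_measure measurable_snd.aestronglyMeasurable hS.aemeasurable]
    exact hTi
  refine ⟨(Kernel.id ×ₖ κ).map T, ⟨inferInstance, ?_⟩, ?_⟩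
  -- Events of the σ-algebra of the new grade have the form "grade in `C`"; pulled back to the old
  -- joint law they become `T ⁻¹' C`, the sets in `hcal`.
  · refine (ae_eq_condExp_of_forall_setIntegral_eq hle (integrable_fst_compProd hF)
      (fun s _ _ => hsnd.integrableOn) ?_
      (comap_measurable Prod.snd).stronglyMeasurable.aestronglyMeasurable).symm
    rintro _ ⟨C, hC, rfl⟩ -
    rw [hmap, setIntegral_map (measurable_snd hC) measurable_snd.aestronglyMeasurable
      hS.aemeasurable, setIntegral_map (measurable_snd hC) measurable_fst.aestronglyMeasurable
      hS.aemeasurable]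
    exact hcal C hC
  · rw [gradeDist, hmap, Measure.map_map measurable_snd hS]
    rfl

end Grading

/-! ### Deviations by pooling; best responses have no atoms. -/

namespace Grading

/-- The transcript structure `κ` maximizes the average placement of a school with ability
distribution `F` under the desirability mapping `Q`. -/
def IsBestResponse (Q : ℝ → ℝ) (F : Measure ℝ) (κ : Kernel ℝ ℝ) : Prop :=
  IsTranscript F κ ∧ ∀ κ', IsTranscript F κ' →
    ∫ x, Q x ∂(gradeDist F κ') ≤ ∫ x, Q x ∂(gradeDist F κ)

/-- On `S`, the grades `T` equal the conditional mean of the ability given the grade. -/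
def CalibratedOn (J : Measure (ℝ × ℝ)) (T : ℝ × ℝ → ℝ) (S : Set (ℝ × ℝ)) : Prop :=
  ∀ C, MeasurableSet C → ∫ p in T ⁻¹' C ∩ S, (T p - p.1) ∂J = 0

open Classical in
/-- Giving grade `c` to the students in `A`, and the grade `T` to the others. -/
noncomputable def pool (T : ℝ × ℝ → ℝ) (A : Set (ℝ × ℝ)) (c : ℝ) (p : ℝ × ℝ) : ℝ :=
  if p ∈ A then c else T p

lemma pool_of_mem {T : ℝ × ℝ → ℝ} {A : Set (ℝ × ℝ)} {c : ℝ} {p : ℝ × ℝ} (hp : p ∈ A) :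
    pool T A c p = c := if_pos hp

lemma pool_of_notMem {T : ℝ × ℝ → ℝ} {A : Set (ℝ × ℝ)} {c : ℝ} {p : ℝ × ℝ} (hp : p ∉ A) :
    pool T A c p = T p := if_neg hp

lemma measurable_pool {T : ℝ × ℝ → ℝ} (hT : Measurable T) {A : Set (ℝ × ℝ)}
    (hA : MeasurableSet A) (c : ℝ) : Measurable (pool T A c) :=
  Measurable.ite hA measurable_const hT

lemma integrable_pool {J : Measure (ℝ × ℝ)} [IsFiniteMeasure J] {T : ℝ × ℝ → ℝ}
    (hT : Integrable T J) {A : Set (ℝ × ℝ)} (hA : MeasurableSet A) (c : ℝ) :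
    Integrable (pool T A c) J := by
  classical exact Integrable.piecewise hA (integrable_const c).integrableOn hT.integrableOn

/-- The group `A` gets its own mean ability as grade, so it contributes nothing to the defect,
whether or not `c ∈ C`. As calibration is tested on disjoint pieces, deviations can be assembled one
group at a time, even if a grade recurs in several pieces. -/
lemma CalibratedOn.pool {J : Measure (ℝ × ℝ)} [IsFiniteMeasure J] {T : ℝ × ℝ → ℝ}
    {S A : Set (ℝ × ℝ)} (h : CalibratedOn J T S) (hTm : Measurable T) (hT : Integrable T J)
    (hfst : Integrable (fun p : ℝ × ℝ => p.1) J) (hS : MeasurableSet S) (hA : MeasurableSet A)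
    (hSA : Disjoint S A) {c : ℝ} (hc : ∫ p in A, p.1 ∂J = c * J.real A) :
    CalibratedOn J (pool T A c) (S ∪ A) := by
  intro C hC
  have hmeas := measurable_pool hTm hA c
  have hint : Integrable (fun p => Grading.pool T A c p - p.1) J := (integrable_pool hT hA c).sub hfst
  rw [inter_union_distrib_left, setIntegral_union (hSA.mono inter_subset_right inter_subset_right)
    ((hmeas hC).inter hA) hint.integrableOn hint.integrableOn]
  have e1 : Grading.pool T A c ⁻¹' C ∩ S = T ⁻¹' C ∩ S := by
    ext p
    simp only [mem_inter_iff, mem_preimage]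
    refine and_congr_left fun hp => ?_
    rw [pool_of_notMem (disjoint_left.1 hSA hp)]
  have h1 : ∫ p in Grading.pool T A c ⁻¹' C ∩ S, (Grading.pool T A c p - p.1) ∂J = 0 := by
    rw [e1, ← h C hC]
    refine setIntegral_congr_fun ((hTm hC).inter hS) fun p hp => ?_
    simp only [pool_of_notMem (disjoint_left.1 hSA hp.2)]
  have h2 : ∫ p in Grading.pool T A c ⁻¹' C ∩ A, (Grading.pool T A c p - p.1) ∂J = 0 := by
    by_cases hcC : c ∈ C
    · have e2 : Grading.pool T A c ⁻¹' C ∩ A = A := inter_eq_right.2 fun p hp => by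
        rwa [mem_preimage, pool_of_mem hp]
      rw [e2, setIntegral_congr_fun (g := fun p => c - p.1) hA fun p hp => by
        simp only [pool_of_mem hp], integral_sub (integrable_const c) hfst.integrableOn, hc]
      simp [mul_comm]
    · have e2 : Grading.pool T A c ⁻¹' C ∩ A = ∅ := eq_empty_of_forall_notMem fun p hp => by
        rw [mem_inter_iff, mem_preimage, pool_of_mem hp.2] at hp
        exact hcC hp.1
      rw [e2, setIntegral_empty]
  rw [h1, h2, add_zero]

lemma calibratedOn_fst (J : Measure (ℝ × ℝ)) (S : Set (ℝ × ℝ)) : CalibratedOn J Prod.fst S :=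
  fun C _ => by simp

lemma integral_gradeDist {Q : ℝ → ℝ} {F : Measure ℝ} {κ : Kernel ℝ ℝ} (hQ : Measurable Q) :
    ∫ x, Q x ∂(gradeDist F κ) = ∫ p, Q p.2 ∂(F ⊗ₘ κ) :=
  integral_map measurable_snd.aemeasurable hQ.aestronglyMeasurable

lemma gradeDist_apply {F : Measure ℝ} {κ : Kernel ℝ ℝ} {B : Set ℝ} (hB : MeasurableSet B) :
    gradeDist F κ B = (F ⊗ₘ κ) (Prod.snd ⁻¹' B) := Measure.map_apply measurable_snd hB

variable {Q : ℝ → ℝ} {F : Measure ℝ} [IsProbabilityMeasure F] {κ : Kernel ℝ ℝ}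

lemma IsTranscript.integrable_snd (hκ : IsTranscript F κ) (hF : ∀ᵐ a ∂F, a ∈ Icc (0 : ℝ) 1) :
    Integrable (fun p : ℝ × ℝ => p.2) (F ⊗ₘ κ) := by
  have := hκ.markov
  exact integrable_of_continuous_of_mem_Icc measurable_snd (hκ.ae_snd_mem_Icc hF) continuous_id

lemma IsTranscript.calibratedOn_snd (hκ : IsTranscript F κ) (hF : ∀ᵐ a ∂F, a ∈ Icc (0 : ℝ) 1)
    {B : Set ℝ} (hB : MeasurableSet B) : CalibratedOn (F ⊗ₘ κ) Prod.snd (Prod.snd ⁻¹' B) := by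
  have := hκ.markov
  intro C hC
  rw [← preimage_inter, integral_sub (hκ.integrable_snd hF).integrableOn
    (integrable_fst_compProd hF).integrableOn, hκ.setIntegral_fst hF (hC.inter hB), sub_self]

lemma integrable_comp_of_bdd {J : Measure (ℝ × ℝ)} [IsFiniteMeasure J] (hQ : Measurable Q)
    (hQb : ∀ x, Q x ∈ Icc (0 : ℝ) 1) {T : ℝ × ℝ → ℝ} (hT : Measurable T) :
    Integrable (fun p => Q (T p)) J :=
  Integrable.of_bound (hQ.comp hT).aestronglyMeasurable 1
    (ae_of_all _ fun p => abs_le.2 ⟨by linarith [(hQb (T p)).1], (hQb (T p)).2⟩)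

/-- No calibrated regrading improves on a best response. -/
lemma IsBestResponse.integral_regrading_le (h : IsBestResponse Q F κ)
    (hF : ∀ᵐ a ∂F, a ∈ Icc (0 : ℝ) 1) (hQ : Measurable Q) {T : ℝ × ℝ → ℝ} (hT : Measurable T)
    (hTi : Integrable T (F ⊗ₘ κ)) (hcal : CalibratedOn (F ⊗ₘ κ) T univ) :
    ∫ p, Q (T p) ∂(F ⊗ₘ κ) ≤ ∫ p, Q p.2 ∂(F ⊗ₘ κ) := by
  have := h.1.markov
  obtain ⟨κ', hκ', hg⟩ := exists_transcript_of_regrading hF hT hTi fun C hC => by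
    have h1 := hcal C hC
    rw [inter_univ, integral_sub hTi.integrableOn (integrable_fst_compProd hF).integrableOn] at h1
    linarith
  have h2 := h.2 κ' hκ'
  rwa [hg, integral_map hT.aemeasurable hQ.aestronglyMeasurable, integral_gradeDist hQ] at h2

/-- Outside `A` grades are unchanged, and that part of the placement cancels. -/
lemma IsBestResponse.setIntegral_regrading_le (h : IsBestResponse Q F κ)
    (hF : ∀ᵐ a ∂F, a ∈ Icc (0 : ℝ) 1) (hQ : Measurable Q) (hQb : ∀ x, Q x ∈ Icc (0 : ℝ) 1)
    {T : ℝ × ℝ → ℝ} (hT : Measurable T)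
    (hTi : Integrable T (F ⊗ₘ κ)) (hcal : CalibratedOn (F ⊗ₘ κ) T univ) {A : Set (ℝ × ℝ)}
    (hA : MeasurableSet A) (hTA : ∀ p ∉ A, T p = p.2) :
    ∫ p in A, Q (T p) ∂(F ⊗ₘ κ) ≤ ∫ p in A, Q p.2 ∂(F ⊗ₘ κ) := by
  have := h.1.markov
  have h1 := h.integral_regrading_le hF hQ hT hTi hcal
  rw [← integral_add_compl hA (integrable_comp_of_bdd hQ hQb hT),
    ← integral_add_compl hA (integrable_comp_of_bdd hQ hQb measurable_snd),
    setIntegral_congr_fun (g := fun p => Q p.2) hA.compl fun p hp => by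
      simp only [hTA p hp]] at h1
  linarith

lemma compProd_fst_preimage [IsMarkovKernel κ] {B : Set ℝ} (hB : MeasurableSet B) :
    (F ⊗ₘ κ) (Prod.fst ⁻¹' B) = F B := by
  rw [← Measure.map_apply measurable_fst hB]
  exact congrArg (· B) (Measure.fst_compProd F κ)

/-- A best response produces no atom where the desirability mapping jumps to the right: the worst
students of the atom would be separated from the others. -/
lemma IsBestResponse.gradeDist_singleton_eq_zero (h : IsBestResponse Q F κ)
    (hF : ∀ᵐ a ∂F, a ∈ Icc (0 : ℝ) 1) [NullSingletonClass F] (hQ : Measurable Q)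
    (hQb : ∀ x, Q x ∈ Icc (0 : ℝ) 1) {x₀ m : ℝ} (hm : Q x₀ < m) (hjump : ∀ x > x₀, m ≤ Q x) :
    gradeDist F κ {x₀} = 0 := by
  have := h.1.markov
  set J := F ⊗ₘ κ with hJ
  set E : Set (ℝ × ℝ) := Prod.snd ⁻¹' {x₀} with hE
  have hEm : MeasurableSet E := measurable_snd (measurableSet_singleton _)
  rw [gradeDist_apply (measurableSet_singleton _), ← hJ, ← hE]
  by_contra hne
  set M := J.real E with hM
  have hMpos : 0 < M := ENNReal.toReal_pos hne (measure_ne_top _ _)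
  have hnull : ∀ a, J (Prod.fst ⁻¹' {a}) = 0 := fun a => by
    rw [hJ, compProd_fst_preimage (measurableSet_singleton a), measure_singleton]
  have hfst_ne : ∀ a, ∀ᵐ p ∂J, p.1 ≠ a := fun a => by
    rw [ae_iff]
    convert hnull a using 2
    ext p
    simp
  have hfst := ae_compProd_fst_mem_Icc κ hF
  have hint := integrable_fst_compProd (κ := κ) hF
  rw [← hJ] at hfst hint
  set μ := (J.restrict E).map Prod.fst with hμ
  have hμB : ∀ B, MeasurableSet B → μ B = J (Prod.fst ⁻¹' B ∩ E) := fun B hB => by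
    rw [hμ, Measure.map_apply measurable_fst hB, Measure.restrict_apply (measurable_fst hB)]
  have : NullSingletonClass μ := ⟨fun a => by
    rw [hμB _ (measurableSet_singleton a)]
    exact measure_mono_null inter_subset_left (hnull a)⟩
  have hm1 : m ≤ 1 := (hjump (x₀ + 1) (by linarith)).trans (hQb _).2
  have hm0 := (hQb x₀).1
  set v := M * (m - Q x₀) / 2 with hv
  have hv0 : 0 < v := by have := mul_pos hMpos (sub_pos.2 hm); linarith
  have hvM : v < M := by nlinarith
  obtain ⟨c, hc, hcv⟩ : ∃ c ∈ Icc (0 : ℝ) 1, J.real (Prod.fst ⁻¹' Ioc 0 c ∩ E) = v := by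
    have hreal : ∀ b, μ.real (Ioc 0 b) = J.real (Prod.fst ⁻¹' Ioc 0 b ∩ E) := fun b => by
      rw [measureReal_def, hμB _ measurableSet_Ioc, ← measureReal_def]
    have h1 : J.real (Prod.fst ⁻¹' Ioc 0 1 ∩ E) = M := by
      refine measureReal_congr ?_
      filter_upwards [hfst, hfst_ne 0] with p hp hp0
      refine propext ⟨fun hh => hh.2, fun hh => ⟨⟨lt_of_le_of_ne hp.1 (Ne.symm hp0), hp.2⟩, hh⟩⟩
    obtain ⟨c, hc, hcv⟩ := exists_measureReal_Ioc_eq μ zero_le_one hv0.le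
      (by rw [hreal, h1]; exact hvM.le)
    exact ⟨c, hc, by rw [← hreal, hcv]⟩
  -- The atom is split by true ability at `c`; omitting ability `0` costs only a null set.
  set L := Prod.fst ⁻¹' Ioc 0 c ∩ E with hL
  set H := E \ L with hH
  have hLm : MeasurableSet L := (measurable_fst measurableSet_Ioc).inter hEm
  have hHm : MeasurableSet H := hEm.diff hLm
  have hLE : L ⊆ E := inter_subset_right
  have hHreal : J.real H = M - v := by rw [hH, measureReal_sdiff hLE hLm, hcv]
  have hHL : Disjoint L H := disjoint_sdiff_right
  have hLH : L ∪ H = E := union_sdiff_cancel hLE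
  set c₁ := (∫ p in L, p.1 ∂J) / v with hc₁
  set c₂ := (∫ p in H, p.1 ∂J) / (M - v) with hc₂
  have hMv : 0 < M - v := sub_pos.2 hvM
  have e₁ : ∫ p in L, p.1 ∂J = c₁ * v := (div_mul_cancel₀ _ hv0.ne').symm
  have e₂ : ∫ p in H, p.1 ∂J = c₂ * (M - v) := (div_mul_cancel₀ _ hMv.ne').symm
  have eE : ∫ p in E, p.1 ∂J = x₀ * M := by
    rw [h.1.setIntegral_fst hF (measurableSet_singleton x₀), ← hE, ← hJ,
      setIntegral_congr_fun (g := fun _ => x₀) hEm fun p hp => hp]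
    simp [mul_comm, hM]
  have eLH : c₁ * v + c₂ * (M - v) = x₀ * M := by
    rw [← e₁, ← e₂, ← eE, ← hLH, setIntegral_union hHL hHm hint.integrableOn hint.integrableOn]
  have hc₁c : c₁ * v ≤ c * v := by
    rw [← e₁, ← hcv]
    calc ∫ p in L, p.1 ∂J ≤ ∫ _ in L, c ∂J :=
          setIntegral_mono_on hint.integrableOn (integrable_const c).integrableOn hLm
            fun p hp => hp.1.2
      _ = c * J.real L := by simp [mul_comm]
  have hc₂c : c * (M - v) < c₂ * (M - v) := by
    rw [← e₂, ← hHreal]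
    have hci : Integrable (fun p : ℝ × ℝ => p.1 - c) (J.restrict H) :=
      (hint.sub (integrable_const c)).integrableOn
    have hpos : ∀ᵐ p ∂(J.restrict H), 0 < p.1 - c := by
      rw [ae_restrict_iff' hHm]
      filter_upwards [hfst, hfst_ne 0] with p hp hp0 hpH
      by_contra hcon
      exact hpH.2 ⟨⟨lt_of_le_of_ne hp.1 (Ne.symm hp0), by linarith⟩, hpH.1⟩
    have h0 : 0 < ∫ p in H, (p.1 - c) ∂J := by
      rw [integral_pos_iff_support_of_nonneg_ae (hpos.mono fun p hp => hp.le) hci]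
      have : (Function.support fun p : ℝ × ℝ => p.1 - c) =ᵐ[J.restrict H] univ := by
        filter_upwards [hpos] with p hp
        exact propext ⟨fun _ => trivial, fun _ => hp.ne'⟩
      rw [measure_congr this, Measure.restrict_apply_univ]
      exact (ENNReal.toReal_pos_iff.1 (show 0 < J.real H by rw [hHreal]; exact hMv)).1
    rw [integral_sub hint.integrableOn (integrable_const c)] at h0
    simp only [integral_const, measureReal_restrict_apply_univ, smul_eq_mul] at h0
    linarith
  -- The means satisfy `c₁ ≤ c < c₂` and average to `x₀`.
  have hc₂x : x₀ < c₂ := by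
    have hcc : c < c₂ := lt_of_mul_lt_mul_right hc₂c hMv.le
    nlinarith
  set T := pool (pool Prod.snd L c₁) H c₂ with hT
  have hT₁m : Measurable (pool Prod.snd L c₁) := measurable_pool measurable_snd hLm _
  have hTm : Measurable T := measurable_pool hT₁m hHm _
  have hT₁i : Integrable (pool Prod.snd L c₁) J :=
    integrable_pool (h.1.integrable_snd hF) hLm _
  have hcal₀ : CalibratedOn J Prod.snd Eᶜ :=
    h.1.calibratedOn_snd hF (measurableSet_singleton x₀).compl
  have hcal₁ := hcal₀.pool measurable_snd (h.1.integrable_snd hF) hint hEm.compl hLm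
    (disjoint_compl_left_iff_subset.2 hLE) (c := c₁) (by rw [e₁, hcv])
  have hcal₂ := hcal₁.pool hT₁m hT₁i hint (hEm.compl.union hLm) hHm
    (disjoint_union_left.2 ⟨disjoint_compl_left_iff_subset.2 sdiff_subset, hHL⟩) (c := c₂)
    (by rw [e₂, hHreal])
  rw [union_assoc, hLH, compl_union_self] at hcal₂
  have hfin := h.setIntegral_regrading_le hF hQ hQb hTm (integrable_pool hT₁i hHm _) hcal₂ hEm
    fun p hp => by
      rw [hT, pool_of_notMem fun hh => hp hh.1, pool_of_notMem fun hh => hp (hLE hh)]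
  rw [← hJ] at hfin
  have hQTi : Integrable (fun p => Q (T p)) J := integrable_comp_of_bdd hQ hQb hTm
  have hr : ∫ p in E, Q p.2 ∂J = M * Q x₀ := by
    rw [setIntegral_congr_fun (g := fun _ => Q x₀) hEm fun p (hp : p.2 = x₀) => by simp only [hp]]
    simp [hM]
  have hl : (M - v) * Q c₂ ≤ ∫ p in E, Q (T p) ∂J := by
    rw [← hLH, setIntegral_union hHL hHm hQTi.integrableOn hQTi.integrableOn]
    have h1 : 0 ≤ ∫ p in L, Q (T p) ∂J := integral_nonneg fun p => (hQb _).1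
    have h2 : ∫ p in H, Q (T p) ∂J = (M - v) * Q c₂ := by
      rw [setIntegral_congr_fun (g := fun _ => Q c₂) hHm fun p hp => by
        simp only [hT, pool_of_mem hp]]
      simp [hHreal]
    linarith
  have hQc₂ := hjump c₂ hc₂x
  have h3 : (M - v) * m ≤ M * Q x₀ :=
    (mul_le_mul_of_nonneg_left hQc₂ hMv.le).trans (hl.trans (hfin.trans hr.le))
  nlinarith

end Grading

/-! ### Local convexity of desirability, and pooling at the top. -/

namespace Grading

variable {Q : ℝ → ℝ} {F : Measure ℝ} [IsProbabilityMeasure F] {κ : Kernel ℝ ℝ}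

/-- A school that produces all grades around `x` cannot gain by pooling grades near `x - δ` and
`x + δ`, so the desirability mapping is midpoint convex there. -/
lemma IsBestResponse.two_mul_le (h : IsBestResponse Q F κ)
    (hF : ∀ᵐ a ∂F, a ∈ Icc (0 : ℝ) 1) (hQ : Continuous Q) (hQb : ∀ x, Q x ∈ Icc (0 : ℝ) 1)
    (hna : ∀ x, gradeDist F κ {x} = 0) {x ε δ : ℝ}
    (hsupp : Ioo (x - ε) (x + ε) ⊆ (gradeDist F κ).support) (hδ0 : 0 < δ) (hδ : δ < ε) :
    2 * Q x ≤ Q (x - δ) + Q (x + δ) := by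
  have := h.1.markov
  set J := F ⊗ₘ κ with hJ
  have hfst := integrable_fst_compProd (κ := κ) hF
  have hsnd := h.1.integrable_snd hF
  rw [← hJ] at hfst hsnd
  have : IsProbabilityMeasure (gradeDist F κ) :=
    Measure.isProbabilityMeasure_map measurable_snd.aemeasurable
  have : NullSingletonClass (gradeDist F κ) := ⟨hna⟩
  by_contra! hcon
  -- The putative gain. Replacing `Q` by its values at `x - δ`, `x + δ` and `x` costs less than `η /
  -- 4` each, and the error at `x` counts twice.
  set η := 2 * Q x - Q (x - δ) - Q (x + δ) with hη
  have hη0 : 0 < η := by linarith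
  have hnear : ∀ y, ∃ ρ > 0, ∀ w, |w - y| ≤ ρ → |Q w - Q y| < η / 4 := fun y => by
    obtain ⟨ρ, hρ, hw⟩ := Metric.continuous_iff.1 hQ y (η / 4) (by linarith)
    exact ⟨ρ / 2, by linarith, fun w hwy => hw w (by rw [Real.dist_eq]; linarith)⟩
  obtain ⟨ρ₁, hρ₁, hn₁⟩ := hnear (x - δ)
  obtain ⟨ρ₂, hρ₂, hn₂⟩ := hnear (x + δ)
  obtain ⟨ρ₃, hρ₃, hn₃⟩ := hnear x
  obtain ⟨ρ, hρ0, hρ⟩ := exists_between (lt_min hδ0 (lt_min hρ₁ (lt_min hρ₂ hρ₃)))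
  simp only [lt_min_iff] at hρ
  have hpos : ∀ y ∈ Ioo (x - ε) (x + ε), 0 < (gradeDist F κ).real (Ioc (y - ρ) (y + ρ)) :=
    fun y hy => ENNReal.toReal_pos
      ((Measure.mem_support_iff_forall y).1 (hsupp hy) _
        (Ioc_mem_nhds (by linarith) (by linarith))).ne' (measure_ne_top _ _)
  have hp₁ := hpos (x - δ) ⟨by linarith, by linarith⟩
  have hp₂ := hpos (x + δ) ⟨by linarith, by linarith⟩
  -- Both bands are trimmed to a common mass, so that the pooled mean lies within `ρ` of `x`; `ρ <
  -- δ` keeps them disjoint.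
  obtain ⟨m, hm0, hm₁, hm₂⟩ : ∃ m > 0, m ≤ (gradeDist F κ).real (Ioc (x - δ - ρ) (x - δ + ρ)) ∧
      m ≤ (gradeDist F κ).real (Ioc (x + δ - ρ) (x + δ + ρ)) :=
    ⟨_, lt_min hp₁ hp₂, min_le_left _ _, min_le_right _ _⟩
  obtain ⟨b₁, hb₁, hmb₁⟩ := exists_measureReal_Ioc_eq _ (by linarith) hm0.le hm₁
  obtain ⟨b₂, hb₂, hmb₂⟩ := exists_measureReal_Ioc_eq _ (by linarith) hm0.le hm₂
  set A₁ : Set (ℝ × ℝ) := Prod.snd ⁻¹' Ioc (x - δ - ρ) b₁ with hA₁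
  set A₂ : Set (ℝ × ℝ) := Prod.snd ⁻¹' Ioc (x + δ - ρ) b₂ with hA₂
  have hA₁m : MeasurableSet A₁ := measurable_snd measurableSet_Ioc
  have hA₂m : MeasurableSet A₂ := measurable_snd measurableSet_Ioc
  have hr₁ : J.real A₁ = m := by
    rw [← hmb₁, measureReal_def, measureReal_def, gradeDist_apply measurableSet_Ioc]
  have hr₂ : J.real A₂ = m := by
    rw [← hmb₂, measureReal_def, measureReal_def, gradeDist_apply measurableSet_Ioc]
  have hdisj : Disjoint A₁ A₂ := by
    refine Disjoint.preimage _ (disjoint_left.2 fun w hw₁ hw₂ => ?_)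
    linarith [hw₁.2, hw₂.1, hb₁.2]
  have hnA₁ : ∀ p ∈ A₁, |p.2 - (x - δ)| ≤ ρ := fun p hp =>
    abs_le.2 ⟨by linarith [hp.1], by linarith [hp.2, hb₁.2]⟩
  have hnA₂ : ∀ p ∈ A₂, |p.2 - (x + δ)| ≤ ρ := fun p hp =>
    abs_le.2 ⟨by linarith [hp.1], by linarith [hp.2, hb₂.2]⟩
  have hupper : ∀ {A : Set (ℝ × ℝ)} {f : ℝ × ℝ → ℝ} {C : ℝ}, MeasurableSet A → Integrable f J →
      (∀ p ∈ A, f p ≤ C) → ∫ p in A, f p ∂J ≤ C * J.real A := fun {A f C} hA hf hC => by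
    calc ∫ p in A, f p ∂J ≤ ∫ _ in A, C ∂J :=
          setIntegral_mono_on hf.integrableOn (integrable_const C).integrableOn hA hC
      _ = C * J.real A := by simp [mul_comm]
  have hlower : ∀ {A : Set (ℝ × ℝ)} {f : ℝ × ℝ → ℝ} {C : ℝ}, MeasurableSet A → Integrable f J →
      (∀ p ∈ A, C ≤ f p) → C * J.real A ≤ ∫ p in A, f p ∂J := fun {A f C} hA hf hC => by
    calc C * J.real A = ∫ _ in A, C ∂J := by simp [mul_comm]
      _ ≤ ∫ p in A, f p ∂J :=
          setIntegral_mono_on (integrable_const C).integrableOn hf.integrableOn hA hC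
  have u₁ := hupper hA₁m hsnd fun p hp => show p.2 ≤ x - δ + ρ by
    linarith [(abs_le.1 (hnA₁ p hp)).2]
  have u₂ := hupper hA₂m hsnd fun p hp => show p.2 ≤ x + δ + ρ by
    linarith [(abs_le.1 (hnA₂ p hp)).2]
  have l₁ := hlower hA₁m hsnd fun p hp => show x - δ - ρ ≤ p.2 by
    linarith [(abs_le.1 (hnA₁ p hp)).1]
  have l₂ := hlower hA₂m hsnd fun p hp => show x + δ - ρ ≤ p.2 by
    linarith [(abs_le.1 (hnA₂ p hp)).1]
  rw [hr₁] at u₁ l₁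
  rw [hr₂] at u₂ l₂
  have hAm : MeasurableSet (A₁ ∪ A₂) := hA₁m.union hA₂m
  have hAreal : J.real (A₁ ∪ A₂) = 2 * m := by
    rw [measureReal_union hdisj hA₂m, hr₁, hr₂]
    ring
  have hAB : A₁ ∪ A₂ = Prod.snd ⁻¹' (Ioc (x - δ - ρ) b₁ ∪ Ioc (x + δ - ρ) b₂) := rfl
  have hsum : ∫ p in A₁ ∪ A₂, p.1 ∂J = ∫ p in A₁, p.2 ∂J + ∫ p in A₂, p.2 ∂J := by
    rw [← setIntegral_union hdisj hA₂m hsnd.integrableOn hsnd.integrableOn, hAB]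
    exact h.1.setIntegral_fst hF (measurableSet_Ioc.union measurableSet_Ioc)
  set c := (∫ p in A₁ ∪ A₂, p.1 ∂J) / (2 * m) with hc
  have hcA : ∫ p in A₁ ∪ A₂, p.1 ∂J = c * (2 * m) :=
    (div_mul_cancel₀ _ (by linarith)).symm
  have hcx : |c - x| ≤ ρ := by
    rw [hsum] at hcA
    refine abs_le.2 ⟨?_, ?_⟩ <;> nlinarith
  have hcal : CalibratedOn J (pool Prod.snd (A₁ ∪ A₂) c) univ := by
    have h1 := (h.1.calibratedOn_snd hF
      (measurableSet_Ioc.union measurableSet_Ioc :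
        MeasurableSet (Ioc (x - δ - ρ) b₁ ∪ Ioc (x + δ - ρ) b₂)).compl).pool measurable_snd hsnd hfst
      hAm.compl hAm disjoint_compl_left (c := c) (by rw [← hJ, hAreal]; exact hcA)
    rwa [preimage_compl, ← hAB, compl_union_self] at h1
  have hfin := h.setIntegral_regrading_le hF hQ.measurable hQb
    (measurable_pool measurable_snd hAm c) (integrable_pool hsnd hAm c) hcal hAm
    fun p hp => pool_of_notMem hp
  rw [← hJ] at hfin
  have hQi : Integrable (fun p : ℝ × ℝ => Q p.2) J :=
    integrable_comp_of_bdd hQ.measurable hQb measurable_snd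
  rw [setIntegral_congr_fun (g := fun _ => Q c) hAm fun p hp => by simp only [pool_of_mem hp],
    setIntegral_union hdisj hA₂m hQi.integrableOn hQi.integrableOn, setIntegral_const, hAreal,
    smul_eq_mul] at hfin
  have v₁ := hupper hA₁m hQi fun p hp => show Q p.2 ≤ Q (x - δ) + η / 4 by
    linarith [(abs_lt.1 (hn₁ p.2 ((hnA₁ p hp).trans hρ.2.1.le))).2]
  have v₂ := hupper hA₂m hQi fun p hp => show Q p.2 ≤ Q (x + δ) + η / 4 by
    linarith [(abs_lt.1 (hn₂ p.2 ((hnA₂ p hp).trans hρ.2.2.1.le))).2]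
  have v₃ := (abs_lt.1 (hn₃ c (hcx.trans hρ.2.2.2.le))).1
  rw [hr₁] at v₁
  rw [hr₂] at v₂
  nlinarith

lemma le_chordExtension {h t x : ℝ} (hQ : ConvexOn ℝ (Iic h) Q) (hth : t < h) (hx : x ≤ h) :
    Q x ≤ chordExtension Q t h x := by
  rcases le_or_gt x t with hxt | hxt
  · rw [chordExtension_of_le hxt]
  rw [chordExtension_of_ge hxt.le]
  rcases hx.eq_or_lt with rfl | hxh
  · rw [div_mul_cancel₀ _ (sub_pos.2 hth).ne']
    linarith
  have h1 := hQ.secant_mono (a := t) (x := x) (y := h) hth.le hx (mem_Iic.2 le_rfl) hxt.ne' hth.ne'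
    hx
  rw [div_le_iff₀ (sub_pos.2 hxt)] at h1
  linarith

/-- A convex function touching a chord at an interior point coincides with it: a strict gap
elsewhere would break the ordering of slopes around `w`. -/
lemma eq_chordExtension_of_eq {h t w z : ℝ} (hQ : ConvexOn ℝ (Iic h) Q) (htw : t < w) (hwh : w < h)
    (hw : Q w = chordExtension Q t h w) (hz : z ∈ Icc t h) : Q z = chordExtension Q t h z := by
  refine le_antisymm (le_chordExtension hQ (htw.trans hwh) hz.2) ?_
  rw [chordExtension_of_ge hz.1]
  rw [chordExtension_of_ge htw.le] at hw
  set s := (Q h - Q t) / (h - t) with hs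
  have hsh : s * (h - t) = Q h - Q t := div_mul_cancel₀ _ (sub_pos.2 (htw.trans hwh)).ne'
  rcases lt_trichotomy z w with hzw | rfl | hwz
  · have h1 := hQ.slope_mono_adjacent (mem_Iic.2 hz.2) (mem_Iic.2 le_rfl) hzw hwh
    have h2 : (Q h - Q w) / (h - w) = s := by
      rw [div_eq_iff (sub_pos.2 hwh).ne']
      linarith
    rw [h2, div_le_iff₀ (sub_pos.2 hzw)] at h1
    linarith
  · exact hw.ge
  · have h1 := hQ.slope_mono_adjacent (mem_Iic.2 (htw.trans hwh).le) (mem_Iic.2 hz.2) htw hwz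
    have h2 : (Q w - Q t) / (w - t) = s := by
      rw [div_eq_iff (sub_pos.2 htw).ne']
      linarith
    rw [h2, le_div_iff₀ (sub_pos.2 hwz)] at h1
    linarith

/-- If `Q` is convex up to the highest grade `b` and some students are abler than `b`, then a best
response pools them along an interval `[t, b]` on which `Q` is affine. -/
lemma IsBestResponse.exists_affine (h : IsBestResponse Q F κ)
    (hF : ∀ᵐ a ∂F, a ∈ Icc (0 : ℝ) 1) [NullSingletonClass F] (hQ : Continuous Q)
    {b : ℝ} (hconv : ConvexOn ℝ (Iic b) Q)
    (hle : ∀ᵐ p ∂(F ⊗ₘ κ), p.2 ≤ b) (hna : gradeDist F κ {b} = 0) (hFb : F (Ioi b) ≠ 0) :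
    ∃ t < b, (∀ x ∈ Icc t b, Q x = chordExtension Q t b x) ∧
      ∫ a, chordExtension Q t b a ∂F ≤ ∫ x, Q x ∂(gradeDist F κ) := by
  have := h.1.markov
  rw [integral_gradeDist hQ.measurable]
  set J := F ⊗ₘ κ with hJ
  have hfst := integrable_fst_compProd (κ := κ) hF
  have hsnd := h.1.integrable_snd hF
  have hsndI := h.1.ae_snd_mem_Icc hF
  rw [← hJ] at hfst hsnd hsndI
  have iF : ∀ f : ℝ → ℝ, Continuous f → Integrable f F := fun f hf =>
    integrable_of_continuous_of_mem_Icc measurable_id hF hf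
  have iJ : ∀ f : ℝ → ℝ, Continuous f → Integrable (fun p : ℝ × ℝ => f p.2) J := fun f hf =>
    integrable_of_continuous_of_mem_Icc measurable_snd hsndI hf
  have hfstmap : ∀ f : ℝ → ℝ, Measurable f → ∫ p, f p.1 ∂J = ∫ a, f a ∂F := fun f hf => by
    have e : J.map Prod.fst = F := Measure.fst_compProd F κ
    rw [← integral_map (f := f) measurable_fst.aemeasurable hf.aestronglyMeasurable, e]
  have hb0 : 0 ≤ b := by
    obtain ⟨p, hp1, hp2⟩ := (hsndI.and hle).exists
    exact hp1.1.trans hp2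
  have hmeanb : ∫ a, a ∂F ≤ b := by
    rw [← hfstmap (fun a => a) measurable_id]
    have e := h.1.setIntegral_fst hF MeasurableSet.univ
    simp only [preimage_univ, Measure.restrict_univ] at e
    calc ∫ p, p.1 ∂J = ∫ p, p.2 ∂J := e
      _ ≤ ∫ _, b ∂J := integral_mono_ae hsnd (integrable_const b) hle
      _ = b := by simp
  -- A zero `t` of `D` is a threshold above which the mean ability is exactly `b`. It exists because
  -- the overall mean is at most `b` while some students exceed `b`.
  set D : ℝ → ℝ := fun t => ∫ a in Ioi t, (a - b) ∂F with hD
  have hDcont : ContinuousOn D (Icc 0 b) := by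
    have h1 : Continuous fun t => ∫ a in (1 : ℝ)..t, (a - b) ∂F :=
      intervalIntegral.continuous_primitive
        (fun c d => (iF _ (by fun_prop)).intervalIntegrable) 1
    have h2 : ∀ t, D t = ∫ a in Ioi 1, (a - b) ∂F - ∫ a in (1 : ℝ)..t, (a - b) ∂F := fun t => by
      have := intervalIntegral.integral_Ioi_sub_Ioi' (μ := F) (f := fun a => a - b) (a := 1)
        (b := t) (iF _ (by fun_prop)).integrableOn (iF _ (by fun_prop)).integrableOn
      simp only [hD]
      linarith
    exact (continuous_const.sub h1 |>.congr fun t => (h2 t).symm).continuousOn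
  have hD0 : D 0 ≤ 0 := by
    have e : D 0 = ∫ a, (a - b) ∂F := by
      refine setIntegral_eq_integral_of_ae_compl_eq_zero ?_ |>.trans rfl
      filter_upwards [hF, measure_eq_zero_iff_ae_notMem.1 (measure_singleton (μ := F) (0 : ℝ))]
        with a ha ha0 hna'
      exact absurd (lt_of_le_of_ne ha.1 (Ne.symm ha0)) hna'
    rw [e, integral_sub (f := fun a => a) (iF _ continuous_id) (integrable_const b)]
    simpa using hmeanb
  have hDb : 0 < D b := by
    rw [hD, setIntegral_pos_iff_support_of_nonneg_ae]
    · have : (Function.support fun a : ℝ => a - b) ∩ Ioi b = Ioi b :=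
        inter_eq_right.2 fun a ha => (sub_pos.2 ha).ne'
      rw [this]
      exact pos_iff_ne_zero.2 hFb
    · rw [Filter.EventuallyLE, ae_restrict_iff' measurableSet_Ioi]
      exact ae_of_all _ fun a ha => (sub_pos.2 ha).le
    · exact (iF _ (by fun_prop)).integrableOn
  obtain ⟨t, ht, hDt⟩ := intermediate_value_Icc hb0 hDcont ⟨hD0, hDb.le⟩
  have htb : t < b := lt_of_le_of_ne ht.2 fun e => by rw [e] at hDt; linarith
  have hFt : F (Ioi t) ≠ 0 := fun e => hFb (measure_mono_null (Ioi_subset_Ioi htb.le) e)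
  -- The deviation reveals abilities up to `t` and pools all others at `b`. As the extension is
  -- affine beyond `t` and the pool has mean `b`, its value is the integral of the extension.
  have hval : ∫ a, chordExtension Q t b a ∂F ≤ ∫ p, Q p.2 ∂J := by
    set A : Set (ℝ × ℝ) := Prod.fst ⁻¹' Ioi t with hA
    have hAm : MeasurableSet A := measurable_fst measurableSet_Ioi
    have hAeq : ∫ p in A, p.1 ∂J = b * J.real A := by
      have e1 : ∫ p in A, (p.1 - b) ∂J = D t := by
        simp only [hD]
        rw [← integral_indicator hAm, ← integral_indicator measurableSet_Ioi]
        exact hfstmap _ ((measurable_id.sub_const b).indicator measurableSet_Ioi)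
      rw [hDt, integral_sub hfst.integrableOn (integrable_const b)] at e1
      simp only [integral_const, measureReal_restrict_apply_univ, smul_eq_mul] at e1
      linarith
    have hcal := (calibratedOn_fst J Aᶜ).pool measurable_fst hfst hfst hAm.compl hAm
      disjoint_compl_left hAeq
    rw [compl_union_self] at hcal
    have h1 := h.integral_regrading_le hF hQ.measurable (measurable_pool measurable_fst hAm b)
      (integrable_pool hfst hAm b) hcal
    refine le_trans (le_of_eq ?_) h1
    set s := (Q b - Q t) / (b - t) with hs
    have hsb : s * (b - t) = Q b - Q t := div_mul_cancel₀ _ (sub_pos.2 htb).ne'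
    have e2 : ∫ a, chordExtension Q t b a ∂F - s * D t
        = ∫ a, (chordExtension Q t b a - s * (Ioi t).indicator (fun a => a - b) a) ∂F := by
      rw [integral_sub (iF _ (continuous_chordExtension hQ t b))
        (((iF _ (by fun_prop)).indicator measurableSet_Ioi).const_mul s), integral_const_mul,
        integral_indicator measurableSet_Ioi]
    have hDt' : D t = 0 := hDt
    rw [hDt', mul_zero, sub_zero] at e2
    rw [e2, ← hfstmap]
    · refine integral_congr_ae (ae_of_all _ fun p => ?_)
      by_cases hp : p ∈ A
      · have hp' : t < p.1 := hp
        simp only [pool_of_mem hp, chordExtension_of_ge hp'.le, indicator_of_mem (mem_Ioi.2 hp')]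
        rw [← hs]
        linarith
      · have hp' : p.1 ∉ Ioi t := hp
        simp only [pool_of_notMem hp, chordExtension_of_le (not_lt.1 hp'), indicator_of_notMem hp']
        ring
    · exact (continuous_chordExtension hQ t b).measurable.sub
        (((measurable_id.sub_const b).indicator measurableSet_Ioi).const_mul s)
  refine ⟨t, htb, ?_, hval⟩
  -- Otherwise `Q` lies strictly below its chord at some `z`. Jensen's inequality and `hval` then
  -- leave no slack: almost every grade produced satisfies `Q = chordExtension Q t b`.
  by_contra! hcon
  obtain ⟨z, hz, hQz⟩ := hcon
  have htz : t < z := lt_of_le_of_ne hz.1 fun e => hQz (by rw [chordExtension_of_le e.ge])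
  have hzb : z < b := lt_of_le_of_ne hz.2 fun e => hQz (by
    rw [e, chordExtension_of_ge htb.le, div_mul_cancel₀ _ (sub_pos.2 htb).ne']
    ring)
  have hRc := continuous_chordExtension hQ t b
  have hjen := h.1.integral_comp_snd_le hF (convexOn_chordExtension hconv htb le_rfl) hRc
  rw [← hJ] at hjen
  have hQR : ∀ᵐ p ∂J, Q p.2 ≤ chordExtension Q t b p.2 :=
    hle.mono fun p hp => le_chordExtension hconv htb hp
  have heq : ∀ᵐ p ∂J, Q p.2 = chordExtension Q t b p.2 := by
    have h1 : ∫ p, (chordExtension Q t b p.2 - Q p.2) ∂J = 0 := by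
      apply le_antisymm
      · rw [integral_sub (iJ _ hRc) (iJ _ hQ)]
        linarith
      · exact integral_nonneg_of_ae (hQR.mono fun p hp => sub_nonneg.2 hp)
    have h2 := (integral_eq_zero_iff_of_nonneg_ae (hQR.mono fun p hp => sub_nonneg.2 hp)
      ((iJ _ hRc).sub (iJ _ hQ))).1 h1
    filter_upwards [h2] with p hp
    exact (sub_eq_zero.1 hp).symm
  have hnb : ∀ᵐ p ∂J, p.2 ≠ b := by
    rw [gradeDist_apply (measurableSet_singleton b)] at hna
    filter_upwards [measure_eq_zero_iff_ae_notMem.1 hna] with p hp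
    exact hp
  -- A grade strictly between `t` and `b` would make `Q` affine, and `b` itself is not an atom.
  have hlt : ∀ᵐ p ∂J, p.2 ≤ t := by
    filter_upwards [hle, heq, hnb] with p hp1 hp2 hp3
    by_contra! hcon
    exact hQz (eq_chordExtension_of_eq hconv hcon (lt_of_le_of_ne hp1 hp3) hp2 hz)
  -- With all grades at most `t`, the flatter extension through `z` bounds the value as well, and it
  -- is strictly smaller than the bound in `hval`.
  have hjen2 := h.1.integral_comp_snd_le hF (convexOn_chordExtension hconv htz hzb.le)
    (continuous_chordExtension hQ t z)
  rw [← hJ, integral_congr_ae (g := fun p => Q p.2)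
    (hlt.mono fun p hp => chordExtension_of_le hp)] at hjen2
  have hslope : (Q z - Q t) / (z - t) < (Q b - Q t) / (b - t) := by
    have h1 := lt_of_le_of_ne (le_chordExtension hconv htb hz.2) hQz
    rw [chordExtension_of_ge hz.1] at h1
    rw [div_lt_iff₀ (sub_pos.2 htz)]
    linarith
  have hdiff : ∀ a, t < a → chordExtension Q t z a < chordExtension Q t b a := fun a ha => by
    rw [chordExtension_of_ge ha.le, chordExtension_of_ge ha.le]
    nlinarith [sub_pos.2 ha]
  have hdiff' : ∀ a, 0 ≤ chordExtension Q t b a - chordExtension Q t z a := fun a => by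
    rcases le_or_gt a t with ha | ha
    · rw [chordExtension_of_le ha, chordExtension_of_le ha, sub_self]
    · exact (sub_pos.2 (hdiff a ha)).le
  have hpos : 0 < ∫ a, (chordExtension Q t b a - chordExtension Q t z a) ∂F := by
    rw [integral_pos_iff_support_of_nonneg hdiff'
      (iF _ (hRc.sub (continuous_chordExtension hQ t z)))]
    refine (pos_iff_ne_zero.2 hFt).trans_le (measure_mono fun a ha => ?_)
    exact (sub_pos.2 (hdiff a ha)).ne'
  rw [integral_sub (iF _ hRc) (iF _ (continuous_chordExtension hQ t z))] at hpos
  linarith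

end Grading

namespace Grading

/-! ### Job quantiles, ranks and desirability in equilibrium. -/

namespace Market

variable {ι : Type*} [Fintype ι] (M : Market ι)

instance isProbabilityMeasure_jobs : IsProbabilityMeasure M.jobs :=
  ⟨by rw [jobs, withDensity_apply _ MeasurableSet.univ, Measure.restrict_univ,
    M.lintegral_jobDensity]⟩

instance nullSingletonClass_jobs : NullSingletonClass M.jobs :=
  ⟨fun x => withDensity_absolutelyContinuous _ _ (measure_singleton x)⟩

/-- The positive density leaves no gaps in the job qualities, so `jobQuantile` is a genuine inverse.
-/
lemma strictMonoOn_jobs : StrictMonoOn (fun x => M.jobs.real (Iic x)) (Icc 0 1) := by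
  intro x hx y hy hxy
  have hpos : M.jobs (Ioc x y) ≠ 0 := by
    rw [jobs, Ne, withDensity_apply_eq_zero' M.measurable_jobDensity.aemeasurable]
    have hIcc : Ioc x y ⊆ Icc 0 1 := fun a ha => ⟨hx.1.trans ha.1.le, ha.2.trans hy.2⟩
    have hsub : Ioc x y ⊆ {a | M.jobDensity a ≠ 0} ∩ Ioc x y := fun a ha =>
      ⟨(M.jobDensity_pos a (hIcc ha)).ne', ha⟩
    intro h0
    have h1 := measure_mono_null hsub h0
    rw [Measure.restrict_apply measurableSet_Ioc, inter_eq_left.2 hIcc, Real.volume_Ioc,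
      ENNReal.ofReal_eq_zero] at h1
    linarith
  have h1 : M.jobs.real (Ioc x y) = M.jobs.real (Iic y) - M.jobs.real (Iic x) := by
    rw [← Iic_sdiff_Iic, measureReal_sdiff (Iic_subset_Iic.2 hxy.le) measurableSet_Iic]
  have h2 : 0 < M.jobs.real (Ioc x y) := ENNReal.toReal_pos hpos (measure_ne_top _ _)
  simp only
  linarith

lemma jobQuantile_jobs {x : ℝ} (hx : x ∈ Icc (0 : ℝ) 1) :
    M.jobQuantile (M.jobs.real (Iic x)) = x := by
  have : {q ∈ Icc (0 : ℝ) 1 | M.jobs.real (Iic x) ≤ M.jobs.real (Iic q)} = Icc x 1 := by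
    ext q
    refine ⟨fun hq => ⟨(M.strictMonoOn_jobs.le_iff_le hx hq.1).1 hq.2, hq.1.2⟩, fun hq => ?_⟩
    exact ⟨⟨hx.1.trans hq.1, hq.2⟩, measureReal_mono (Iic_subset_Iic.2 hq.1)⟩
  rw [jobQuantile, this, csInf_Icc hx.2]

lemma jobs_Iic_zero : M.jobs.real (Iic 0) = 0 := by
  rw [measureReal_def, jobs, withDensity_absolutelyContinuous _ _ _, ENNReal.toReal_zero]
  rw [Measure.restrict_apply measurableSet_Iic]
  refine measure_mono_null (t := {0}) (fun a ha => le_antisymm ha.1 ha.2.1) (measure_singleton 0)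

lemma jobs_Iic_one : M.jobs.real (Iic 1) = 1 := by
  have h0 : M.jobs (Iic 1)ᶜ = 0 := by
    refine withDensity_absolutelyContinuous _ _ ?_
    rw [Measure.restrict_apply measurableSet_Iic.compl]
    exact measure_mono_null (t := ∅) (fun a ha => ha.1 ha.2.2) measure_empty
  rw [measureReal_def, (prob_compl_eq_zero_iff measurableSet_Iic).1 h0, ENNReal.toReal_one]

lemma exists_jobs_eq {u : ℝ} (hu : u ∈ Icc (0 : ℝ) 1) :
    ∃ x ∈ Icc (0 : ℝ) 1, M.jobs.real (Iic x) = u :=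
  intermediate_value_Icc zero_le_one (continuous_real_Iic M.jobs).continuousOn
    (by simpa only [jobs_Iic_zero, jobs_Iic_one] using hu)

lemma jobQuantile_zero : M.jobQuantile 0 = 0 := by
  have h := M.jobQuantile_jobs (x := 0) ⟨le_rfl, zero_le_one⟩
  rwa [jobs_Iic_zero] at h

lemma jobQuantile_mem {u : ℝ} (hu : u ∈ Icc (0 : ℝ) 1) : M.jobQuantile u ∈ Icc (0 : ℝ) 1 := by
  obtain ⟨x, hx, rfl⟩ := M.exists_jobs_eq hu
  rwa [M.jobQuantile_jobs hx]

lemma strictMonoOn_jobQuantile : StrictMonoOn M.jobQuantile (Icc 0 1) := by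
  intro u hu v hv huv
  obtain ⟨x, hx, rfl⟩ := M.exists_jobs_eq hu
  obtain ⟨y, hy, rfl⟩ := M.exists_jobs_eq hv
  rw [M.jobQuantile_jobs hx, M.jobQuantile_jobs hy]
  exact (M.strictMonoOn_jobs.lt_iff_lt hx hy).1 huv

/-- A monotone surjection of `[0,1]` onto itself is continuous. -/
lemma continuousOn_jobQuantile : ContinuousOn M.jobQuantile (Icc 0 1) := by
  have hmono : Monotone fun u : Icc (0 : ℝ) 1 =>
      (⟨M.jobQuantile u, M.jobQuantile_mem u.2⟩ : Icc (0 : ℝ) 1) :=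
    fun u v huv => M.strictMonoOn_jobQuantile.monotoneOn u.2 v.2 huv
  have hsurj : Function.Surjective fun u : Icc (0 : ℝ) 1 =>
      (⟨M.jobQuantile u, M.jobQuantile_mem u.2⟩ : Icc (0 : ℝ) 1) := fun x =>
    ⟨⟨M.jobs.real (Iic x), measureReal_nonneg, measureReal_le_one⟩,
      Subtype.ext (M.jobQuantile_jobs x.2)⟩
  exact continuousOn_iff_continuous_domRestrict.2
    (continuous_subtype_val.comp (hmono.continuous_of_surjective hsurj))

end Market

lemma rank_mem_Icc (G : Measure ℝ) [IsProbabilityMeasure G] (x : ℝ) {t : ℝ}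
    (ht : t ∈ Icc (0 : ℝ) 1) : rank G x t ∈ Icc (G.real (Iio x)) (G.real (Iic x)) := by
  have h1 : G.real (Iio x) ≤ G.real (Iic x) := measureReal_mono Iio_subset_Iic_self
  constructor <;> simp only [rank] <;> nlinarith [ht.1, ht.2]

lemma rank_mem_unit (G : Measure ℝ) [IsProbabilityMeasure G] (x : ℝ) {t : ℝ}
    (ht : t ∈ Icc (0 : ℝ) 1) : rank G x t ∈ Icc (0 : ℝ) 1 :=
  ⟨measureReal_nonneg.trans (rank_mem_Icc G x ht).1,
    (rank_mem_Icc G x ht).2.trans measureReal_le_one⟩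

lemma rank_mono (G : Measure ℝ) [IsProbabilityMeasure G] {x y t : ℝ} (ht : t ∈ Icc (0 : ℝ) 1)
    (hxy : x ≤ y) : rank G x t ≤ rank G y t :=
  add_le_add
    (mul_le_mul_of_nonneg_left (measureReal_mono (Iio_subset_Iio hxy)) (by linarith [ht.2]))
    (mul_le_mul_of_nonneg_left (measureReal_mono (Iic_subset_Iic.2 hxy)) ht.1)

lemma rank_eq_real_Iic (G : Measure ℝ) [NullSingletonClass G] (x t : ℝ) :
    rank G x t = G.real (Iic x) := by
  have : G.real (Iio x) = G.real (Iic x) := measureReal_congr Iio_ae_eq_Iic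
  rw [rank, this]
  ring

namespace Market

variable {ι : Type*} [Fintype ι] (M : Market ι) {φ : ι → Kernel ℝ ℝ}

lemma isProbabilityMeasure_gradeDist (hφ : M.IsProfile φ) (i : ι) :
    IsProbabilityMeasure (gradeDist (M.ability i) (φ i)) := by
  have := M.ability_prob i
  have := (hφ i).markov
  exact Measure.isProbabilityMeasure_map measurable_snd.aemeasurable

lemma isProbabilityMeasure_sum (μ : ι → Measure ℝ) [∀ i, IsProbabilityMeasure (μ i)] :
    IsProbabilityMeasure (∑ i, M.weight i • μ i) := by
  constructor
  simp only [Measure.coe_finsetSum, Finset.sum_apply, Measure.smul_apply, measure_univ]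
  have := congrArg (fun r : ℝ≥0 => (r : ℝ≥0∞)) M.sum_weight
  simpa [ENNReal.smul_def] using this

lemma isProbabilityMeasure_aggregateGrade (hφ : M.IsProfile φ) :
    IsProbabilityMeasure (M.aggregateGrade φ) := by
  have := M.isProbabilityMeasure_gradeDist hφ
  exact M.isProbabilityMeasure_sum _

lemma integral_sum_weight {μ : ι → Measure ℝ} {f : ℝ → ℝ} (hf : ∀ i, Integrable f (μ i)) :
    ∫ x, f x ∂(∑ i, M.weight i • μ i) = ∑ i, (M.weight i : ℝ) * ∫ x, f x ∂(μ i) := by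
  rw [integral_finsetSum_measure fun i _ => (hf i).smul_measure_nnreal]
  simp [integral_smul_nnreal_measure, NNReal.smul_def]

lemma sum_weight_apply_eq_zero_iff (μ : ι → Measure ℝ) (s : Set ℝ) :
    (∑ i, M.weight i • μ i) s = 0 ↔ ∀ i, μ i s = 0 := by
  simp only [Measure.coe_finsetSum, Finset.sum_apply, Finset.sum_eq_zero_iff, Finset.mem_univ,
    forall_const, Measure.smul_apply, ENNReal.smul_def, smul_eq_mul, mul_eq_zero,
    ENNReal.coe_eq_zero, (M.weight_pos _).ne', false_or]

lemma continuousOn_jobQuantile_rank (hφ : M.IsProfile φ) (x : ℝ) :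
    ContinuousOn (fun t => M.jobQuantile (rank (M.aggregateGrade φ) x t)) (Icc 0 1) := by
  have := M.isProbabilityMeasure_aggregateGrade hφ
  refine M.continuousOn_jobQuantile.comp (Continuous.continuousOn ?_) fun t ht =>
    rank_mem_unit _ _ ht
  unfold rank
  fun_prop

lemma intervalIntegrable_jobQuantile_rank (hφ : M.IsProfile φ) (x : ℝ) :
    IntervalIntegrable (fun t => M.jobQuantile (rank (M.aggregateGrade φ) x t)) volume 0 1 :=
  ContinuousOn.intervalIntegrable (by
    rw [uIcc_of_le zero_le_one]
    exact M.continuousOn_jobQuantile_rank hφ x)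

lemma monotone_desirability (hφ : M.IsProfile φ) : Monotone (M.desirability φ) := by
  have := M.isProbabilityMeasure_aggregateGrade hφ
  exact fun x y hxy => intervalIntegral.integral_mono_on zero_le_one
    (M.intervalIntegrable_jobQuantile_rank hφ x) (M.intervalIntegrable_jobQuantile_rank hφ y)
    fun t ht => M.strictMonoOn_jobQuantile.monotoneOn (rank_mem_unit _ _ ht)
      (rank_mem_unit _ _ ht) (rank_mono _ ht hxy)

lemma desirability_mem (hφ : M.IsProfile φ) (x : ℝ) : M.desirability φ x ∈ Icc (0 : ℝ) 1 := by
  have := M.isProbabilityMeasure_aggregateGrade hφ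
  refine ⟨intervalIntegral.integral_nonneg zero_le_one fun t ht =>
    (M.jobQuantile_mem (rank_mem_unit _ _ ht)).1, ?_⟩
  calc M.desirability φ x ≤ ∫ _ in (0 : ℝ)..1, (1 : ℝ) :=
        intervalIntegral.integral_mono_on zero_le_one (M.intervalIntegrable_jobQuantile_rank hφ x)
          (by simp) fun t ht => (M.jobQuantile_mem (rank_mem_unit _ _ ht)).2
    _ = 1 := by simp

lemma le_desirability_of_lt (hφ : M.IsProfile φ) {x y : ℝ} (hxy : x < y) :
    M.jobQuantile ((M.aggregateGrade φ).real (Iic x)) ≤ M.desirability φ y := by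
  have := M.isProbabilityMeasure_aggregateGrade hφ
  calc _ = ∫ _ in (0 : ℝ)..1, M.jobQuantile ((M.aggregateGrade φ).real (Iic x)) := by simp
    _ ≤ _ := intervalIntegral.integral_mono_on zero_le_one (by simp)
        (M.intervalIntegrable_jobQuantile_rank hφ y) fun t ht =>
        M.strictMonoOn_jobQuantile.monotoneOn ⟨measureReal_nonneg, measureReal_le_one⟩
          (rank_mem_unit _ _ ht)
          ((measureReal_mono (Iic_subset_Iio.2 hxy)).trans (rank_mem_Icc _ _ ht).1)

/-- Tied students average over a nondegenerate interval of ranks, whereas every higher grade beats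
the top rank of the tie (`le_desirability_of_lt`): desirability jumps to the right of an atom. -/
lemma desirability_lt_of_atom (hφ : M.IsProfile φ) {x : ℝ} (hx : M.aggregateGrade φ {x} ≠ 0) :
    M.desirability φ x < M.jobQuantile ((M.aggregateGrade φ).real (Iic x)) := by
  have := M.isProbabilityMeasure_aggregateGrade hφ
  have hlt : (M.aggregateGrade φ).real (Iio x) < (M.aggregateGrade φ).real (Iic x) := by
    have h1 : (M.aggregateGrade φ).real (Iic x)
        = (M.aggregateGrade φ).real (Iio x) + (M.aggregateGrade φ).real {x} := by
      rw [← measureReal_union (by simp) (measurableSet_singleton x), Iio_union_right]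
    have h2 : 0 < (M.aggregateGrade φ).real {x} := ENNReal.toReal_pos hx (measure_ne_top _ _)
    linarith
  calc M.desirability φ x
      < ∫ _ in (0 : ℝ)..1, M.jobQuantile ((M.aggregateGrade φ).real (Iic x)) := by
        refine intervalIntegral.integral_lt_integral_of_continuousOn_of_le_of_exists_lt zero_lt_one
          (M.continuousOn_jobQuantile_rank hφ x) continuousOn_const (fun t ht => ?_)
          ⟨0, ⟨le_rfl, zero_le_one⟩, ?_⟩
        · exact M.strictMonoOn_jobQuantile.monotoneOn (rank_mem_unit _ _ ⟨ht.1.le, ht.2⟩)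
            ⟨measureReal_nonneg, measureReal_le_one⟩ (rank_mem_Icc _ _ ⟨ht.1.le, ht.2⟩).2
        · refine M.strictMonoOn_jobQuantile (rank_mem_unit _ _ ⟨le_rfl, zero_le_one⟩)
            ⟨measureReal_nonneg, measureReal_le_one⟩ ?_
          simpa [rank] using hlt
    _ = _ := by simp

lemma IsEquilibrium.isBestResponse {M : Market ι} (h : M.IsEquilibrium φ) (i : ι) :
    IsBestResponse (M.desirability φ) (M.ability i) (φ i) :=
  ⟨h.1 i, h.2 i⟩

lemma nullSingletonClass_ability
    (huniform : M.aggregateAbility = volume.restrict (Icc 0 1)) (i : ι) :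
    NullSingletonClass (M.ability i) :=
  ⟨fun x => (M.sum_weight_apply_eq_zero_iff M.ability {x}).1 (by
    rw [← aggregateAbility, huniform, measure_singleton]) i⟩

/-- Either the aggregate has no atom at `x`, and then no type has one, or desirability jumps there
and every type avoids it. -/
lemma IsEquilibrium.gradeDist_singleton {M : Market ι} (h : M.IsEquilibrium φ)
    (huniform : M.aggregateAbility = volume.restrict (Icc 0 1)) (i : ι) (x : ℝ) :
    gradeDist (M.ability i) (φ i) {x} = 0 := by
  have := M.ability_prob i
  have := M.nullSingletonClass_ability huniform i
  by_cases hx : M.aggregateGrade φ {x} = 0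
  · exact (M.sum_weight_apply_eq_zero_iff _ {x}).1 hx i
  · exact (h.isBestResponse i).gradeDist_singleton_eq_zero (M.ability_supp i)
      (M.monotone_desirability h.1).measurable (M.desirability_mem h.1)
      (M.desirability_lt_of_atom h.1 hx) fun y hy => M.le_desirability_of_lt h.1 hy

lemma IsEquilibrium.nullSingletonClass_aggregateGrade {M : Market ι} (h : M.IsEquilibrium φ)
    (huniform : M.aggregateAbility = volume.restrict (Icc 0 1)) :
    NullSingletonClass (M.aggregateGrade φ) :=
  ⟨fun x => (M.sum_weight_apply_eq_zero_iff _ {x}).2 fun i => h.gradeDist_singleton huniform i x⟩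

lemma desirability_eq_jobQuantile [NullSingletonClass (M.aggregateGrade φ)] (x : ℝ) :
    M.desirability φ x = M.jobQuantile ((M.aggregateGrade φ).real (Iic x)) := by
  simp [desirability, rank_eq_real_Iic]

lemma continuous_desirability (hφ : M.IsProfile φ) [NullSingletonClass (M.aggregateGrade φ)] :
    Continuous (M.desirability φ) := by
  have := M.isProbabilityMeasure_aggregateGrade hφ
  simp only [funext M.desirability_eq_jobQuantile]
  exact M.continuousOn_jobQuantile.comp_continuous (continuous_real_Iic _)
    fun x => ⟨measureReal_nonneg, measureReal_le_one⟩

lemma ae_gradeDist_mem_Icc (hφ : M.IsProfile φ) (i : ι) :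
    ∀ᵐ x ∂(gradeDist (M.ability i) (φ i)), x ∈ Icc (0 : ℝ) 1 := by
  have := M.ability_prob i
  exact (ae_map_iff measurable_snd.aemeasurable measurableSet_Icc).2
    ((hφ i).ae_snd_mem_Icc (M.ability_supp i))

lemma ae_aggregateGrade_iff {p : ℝ → Prop} :
    (∀ᵐ x ∂(M.aggregateGrade φ), p x) ↔ ∀ i, ∀ᵐ x ∂(gradeDist (M.ability i) (φ i)), p x :=
  M.sum_weight_apply_eq_zero_iff _ _

lemma support_aggregateGrade_subset (hφ : M.IsProfile φ) :
    (M.aggregateGrade φ).support ⊆ Icc 0 1 :=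
  Measure.support_subset_of_isClosed isClosed_Icc
    ((M.ae_aggregateGrade_iff (p := (· ∈ Icc 0 1))).2 (M.ae_gradeDist_mem_Icc hφ))

lemma ae_le_sSup_support (hφ : M.IsProfile φ) :
    ∀ᵐ x ∂(M.aggregateGrade φ), x ≤ sSup (M.aggregateGrade φ).support := by
  filter_upwards [Measure.support_mem_ae] with x hx
  exact le_csSup ⟨1, fun y hy => (M.support_aggregateGrade_subset hφ hy).2⟩ hx

lemma desirability_eq_zero (hφ : M.IsProfile φ) [NullSingletonClass (M.aggregateGrade φ)] {x : ℝ}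
    (hx : x ≤ sInf (M.aggregateGrade φ).support) : M.desirability φ x = 0 := by
  have h0 : M.aggregateGrade φ (Iio x) = 0 := by
    refine measure_mono_null (t := (M.aggregateGrade φ).supportᶜ) (fun y hy hy' => ?_)
      Measure.measure_compl_support
    exact (hy.trans_le hx).not_ge
      (csInf_le ⟨0, fun z hz => (M.support_aggregateGrade_subset hφ hz).1⟩ hy')
  rw [M.desirability_eq_jobQuantile, measureReal_def, ← measure_congr Iio_ae_eq_Iic, h0,
    ENNReal.toReal_zero, M.jobQuantile_zero]

/-- In a connected equilibrium, desirability is convex up to the highest grade produced. -/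
lemma IsEquilibrium.convexOn_desirability {M : Market ι} (h : M.IsEquilibrium φ)
    (huniform : M.aggregateAbility = volume.restrict (Icc 0 1)) (hconn : M.IsConnected φ) :
    ConvexOn ℝ (Iic (sSup (M.aggregateGrade φ).support)) (M.desirability φ) := by
  have := h.nullSingletonClass_aggregateGrade huniform
  have hc := M.continuous_desirability h.1
  refine convexOn_Iic_of_locally_midpoint hc fun x hx => ?_
  -- Connectedness says nothing at or below the lowest grade, but there `Q x = 0` and `Q` is
  -- nonnegative.
  rcases le_or_gt x (sInf (M.aggregateGrade φ).support) with hx' | hx'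
  · refine ⟨1, one_pos, fun δ _ _ => ?_⟩
    rw [M.desirability_eq_zero h.1 hx']
    linarith [(M.desirability_mem h.1 (x - δ)).1, (M.desirability_mem h.1 (x + δ)).1]
  · obtain ⟨i, ε, hε, hsub⟩ := hconn x ⟨hx', hx⟩
    have := M.ability_prob i
    exact ⟨ε, hε, fun δ hδ0 hδ => (h.isBestResponse i).two_mul_le (M.ability_supp i) hc
      (M.desirability_mem h.1) (h.gradeDist_singleton huniform i) hsub hδ0 hδ⟩

end Market

lemma chordExtension_eq_of_affine {Q : ℝ → ℝ} {t b x : ℝ}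
    (h : ∀ y ∈ Icc t b, Q y = chordExtension Q t b y) (hx : x ≤ b) :
    chordExtension Q t b x = Q x := by
  rcases le_or_gt x t with hxt | hxt
  · exact chordExtension_of_le hxt
  · exact (h x ⟨hxt.le, hx⟩).symm

lemma chordExtension_eq_of_le {Q : ℝ → ℝ} {t t' b : ℝ} (htt : t ≤ t') (htb : t' < b)
    (h : ∀ y ∈ Icc t b, Q y = chordExtension Q t b y) :
    chordExtension Q t' b = chordExtension Q t b := by
  have ht := h t' ⟨htt, htb.le⟩
  rw [chordExtension_of_ge htt] at ht
  have hs : (Q b - Q t') / (b - t') = (Q b - Q t) / (b - t) := by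
    have : (Q b - Q t) / (b - t) * (b - t) = Q b - Q t :=
      div_mul_cancel₀ _ (by linarith)
    rw [div_eq_iff (by linarith)]
    linarith
  ext x
  rcases le_or_gt x t' with hx | hx
  · rw [chordExtension_of_le hx, chordExtension_eq_of_affine h (hx.trans htb.le)]
  · rw [chordExtension_of_ge hx.le, chordExtension_of_ge (htt.trans hx.le), hs]
    linarith

/-- The threshold `t` depends on the type, but all extensions continue the same line along which `Q`
reaches `b`; hence one `P` serves every type. -/
lemma chordExtension_eq {Q : ℝ → ℝ} {t t' b : ℝ} (htb : t < b) (htb' : t' < b)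
    (h : ∀ y ∈ Icc t b, Q y = chordExtension Q t b y)
    (h' : ∀ y ∈ Icc t' b, Q y = chordExtension Q t' b y) :
    chordExtension Q t' b = chordExtension Q t b := by
  rcases le_total t t' with htt | htt
  · exact chordExtension_eq_of_le htt htb' h
  · exact (chordExtension_eq_of_le htt htb h').symm

/-! ### The common convex extension and the comparison of welfares. -/

namespace Market

variable {ι : Type*} [Fintype ι] {M : Market ι} {φ : ι → Kernel ℝ ℝ}

lemma IsEquilibrium.truthful_le (h : M.IsEquilibrium φ) (i : ι) :
    ∫ a, M.desirability φ a ∂(M.ability i)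
      ≤ ∫ x, M.desirability φ x ∂(gradeDist (M.ability i) (φ i)) := by
  have := M.ability_prob i
  have := (h.1 i).markov
  have hm := (M.monotone_desirability h.1).measurable
  have h1 := (h.isBestResponse i).integral_regrading_le (M.ability_supp i) hm measurable_fst
    (integrable_fst_compProd (M.ability_supp i)) (calibratedOn_fst _ _)
  rw [integral_gradeDist hm]
  refine le_trans (le_of_eq ?_) h1
  have e : (M.ability i ⊗ₘ φ i).map Prod.fst = M.ability i :=
    Measure.fst_compProd (M.ability i) (φ i)
  rw [← integral_map (f := M.desirability φ) measurable_fst.aemeasurable hm.aestronglyMeasurable, e]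

/-- In a connected equilibrium the desirability mapping on the grades produced extends to a convex
function for which the schools do no better by full revelation. -/
lemma IsEquilibrium.exists_convex_extension (h : M.IsEquilibrium φ)
    (huniform : M.aggregateAbility = volume.restrict (Icc 0 1)) (hconn : M.IsConnected φ) :
    ∃ P : ℝ → ℝ, Continuous P ∧ Monotone P ∧ (∀ x ∈ Icc (0 : ℝ) 1, 0 ≤ P x) ∧
      ConvexOn ℝ (Icc 0 1) P ∧
      (∀ x ≤ sSup (M.aggregateGrade φ).support, P x = M.desirability φ x) ∧
      ∀ i, ∫ a, P a ∂(M.ability i)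
        ≤ ∫ x, M.desirability φ x ∂(gradeDist (M.ability i) (φ i)) := by
  have := h.nullSingletonClass_aggregateGrade huniform
  have := M.isProbabilityMeasure_aggregateGrade h.1
  have hc := M.continuous_desirability h.1
  have hmono := M.monotone_desirability h.1
  have hmem := M.desirability_mem h.1
  have hconv := h.convexOn_desirability huniform hconn
  have hle := M.ae_le_sSup_support h.1
  have hsup0 : 0 ≤ sSup (M.aggregateGrade φ).support :=
    Real.sSup_nonneg fun x hx => (M.support_aggregateGrade_subset h.1 hx).1
  set b := sSup (M.aggregateGrade φ).support with hb
  have haff : ∀ i, M.ability i (Ioi b) ≠ 0 → ∃ t < b,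
      (∀ x ∈ Icc t b, M.desirability φ x = chordExtension (M.desirability φ) t b x) ∧
      ∫ a, chordExtension (M.desirability φ) t b a ∂(M.ability i)
        ≤ ∫ x, M.desirability φ x ∂(gradeDist (M.ability i) (φ i)) := fun i hi => by
    have := M.ability_prob i
    have := M.nullSingletonClass_ability huniform i
    exact (h.isBestResponse i).exists_affine (M.ability_supp i) hc hconv
      (ae_of_ae_map measurable_snd.aemeasurable (M.ae_aggregateGrade_iff.1 hle i))
      (h.gradeDist_singleton huniform i b) hi
  by_cases hall : ∀ i, M.ability i (Ioi b) = 0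
  -- With uniform aggregate ability, nobody is abler than `b` only if `b ≥ 1`, and then `Q` itself
  -- serves as `P`.
  · have h1 : 1 ≤ b := by
      have h0 : M.aggregateAbility (Ioi b) = 0 := (M.sum_weight_apply_eq_zero_iff _ _).2 hall
      rw [huniform, Measure.restrict_apply measurableSet_Ioi] at h0
      by_contra! hb1
      have hsub : Ioc b 1 ⊆ Ioi b ∩ Icc 0 1 := fun x hx => ⟨hx.1, hsup0.trans hx.1.le, hx.2⟩
      have h2 := measure_mono_null hsub h0
      rw [Real.volume_Ioc, ENNReal.ofReal_eq_zero] at h2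
      linarith
    exact ⟨M.desirability φ, hc, hmono, fun x _ => (hmem x).1,
      hconv.subset (fun x hx => hx.2.trans h1) (convex_Icc 0 1), fun _ _ => rfl, h.truthful_le⟩
  · push Not at hall
    obtain ⟨j, hj⟩ := hall
    obtain ⟨t, htb, ht, -⟩ := haff j hj
    refine ⟨chordExtension (M.desirability φ) t b, continuous_chordExtension hc t b,
      monotone_chordExtension hmono htb, fun x hx => ?_,
      (convexOn_chordExtension hconv htb le_rfl).subset (subset_univ _) (convex_Icc 0 1),
      fun x hx => chordExtension_eq_of_affine ht hx, fun i => ?_⟩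
    · refine le_trans ?_ (monotone_chordExtension hmono htb hx.1)
      rw [chordExtension_eq_of_affine ht hsup0]
      exact (hmem 0).1
    -- A type without students above `b` sees `P = Q` on its abilities, so revealing them is the
    -- deviation to compare with.
    · by_cases hi : M.ability i (Ioi b) = 0
      · refine le_trans (le_of_eq (integral_congr_ae ?_)) (h.truthful_le i)
        filter_upwards [measure_eq_zero_iff_ae_notMem.1 hi] with a ha
        exact chordExtension_eq_of_affine ht (not_lt.1 ha)
      · obtain ⟨t', htb', ht', hint⟩ := haff i hi
        rwa [chordExtension_eq htb htb' ht ht'] at hint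

lemma integral_aggregateAbility
    (huniform : M.aggregateAbility = volume.restrict (Icc 0 1)) {f : ℝ → ℝ}
    (hf : ∀ i, Integrable f (M.ability i)) :
    ∑ i, (M.weight i : ℝ) * ∫ a, f a ∂(M.ability i) = ∫ u in (0 : ℝ)..1, f u := by
  rw [← M.integral_sum_weight hf, intervalIntegral.integral_of_le zero_le_one,
    ← integral_Icc_eq_integral_Ioc, ← huniform, aggregateAbility]

lemma gradeDist_id (F : Measure ℝ) [SFinite F] : gradeDist F Kernel.id = F := by
  rw [gradeDist, Measure.compProd_id, Measure.map_map measurable_snd (by fun_prop)]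
  exact Measure.map_id

/-- Aggregate ability being uniform, a truthfully graded student of ability `a` has rank `a`. -/
lemma truthfulWelfare_eq (huniform : M.aggregateAbility = volume.restrict (Icc 0 1)) :
    M.truthfulWelfare id id = ∫ u in (0 : ℝ)..1, u * M.jobQuantile u := by
  have := M.ability_prob
  have hagg : (M.aggregateGrade fun _ => Kernel.id) = volume.restrict (Icc 0 1) := by
    rw [aggregateGrade, ← huniform, aggregateAbility]
    simp only [gradeDist_id]
  have hq : ContinuousOn (fun u => u * M.jobQuantile u) (Icc 0 1) :=
    continuousOn_id.mul M.continuousOn_jobQuantile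
  have hI : ∀ i, (M.ability i).restrict (Icc 0 1) = M.ability i := fun i =>
    Measure.restrict_eq_self_of_ae_mem (M.ability_supp i)
  have hint : ∀ i, Integrable (fun u => u * M.jobQuantile u) (M.ability i) := fun i => by
    have := hq.integrableOn_compact (μ := M.ability i) isCompact_Icc
    rwa [IntegrableOn, hI] at this
  rw [← integral_aggregateAbility huniform hint, truthfulWelfare, welfare]
  refine Finset.sum_congr rfl fun i _ => ?_
  congr 1
  have : NullSingletonClass (volume.restrict (Icc (0 : ℝ) 1)) := inferInstance
  simp only [hagg, rank_eq_real_Iic, id, intervalIntegral.integral_const, sub_zero, one_smul]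
  have hcdf : ∀ a ∈ Icc (0 : ℝ) 1, (volume.restrict (Icc (0 : ℝ) 1)).real (Iic a) = a :=
    fun a ha => by
      have : Iic a ∩ Icc 0 1 = Icc 0 a := by
        ext x
        simp only [mem_inter_iff, mem_Iic, mem_Icc]
        exact ⟨fun h => ⟨h.2.1, h.1⟩, fun h => ⟨h.2, h.1, h.2.trans ha.2⟩⟩
      rw [measureReal_def, Measure.restrict_apply measurableSet_Iic, this, Real.volume_Icc,
        sub_zero, ENNReal.toReal_ofReal ha.1]
  have hae : ∀ᵐ a ∂(M.ability i), a * M.jobQuantile ((volume.restrict (Icc (0 : ℝ) 1)).real (Iic a))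
      = a * M.jobQuantile a := (M.ability_supp i).mono fun a ha => by
    simp only [hcdf a ha]
  rw [Measure.compProd_id, integral_map (by fun_prop)]
  · exact integral_congr_ae hae
  · have hU : IsProbabilityMeasure (volume.restrict (Icc (0 : ℝ) 1)) :=
      huniform ▸ M.isProbabilityMeasure_sum M.ability
    have hcont := M.continuousOn_jobQuantile.comp_continuous
      (continuous_real_Iic (volume.restrict (Icc (0 : ℝ) 1)))
      fun x => ⟨measureReal_nonneg, measureReal_le_one⟩
    exact (continuous_fst.mul (hcont.comp continuous_snd)).aestronglyMeasurable

/-- By calibration the true ability may be replaced by the grade, the job depending on the grade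
only. -/
lemma welfare_eq (hφ : M.IsProfile φ) (hQ : Continuous (M.desirability φ)) :
    M.welfare id id φ = ∫ x, x * M.desirability φ x ∂(M.aggregateGrade φ) := by
  have := M.ability_prob
  have hmem := M.desirability_mem hφ
  have := M.isProbabilityMeasure_gradeDist hφ
  rw [aggregateGrade, M.integral_sum_weight (f := fun x => x * M.desirability φ x) fun i =>
    integrable_of_continuous_of_mem_Icc measurable_id (M.ae_gradeDist_mem_Icc hφ i)
      (f := fun x => x * M.desirability φ x) (by fun_prop), welfare]
  refine Finset.sum_congr rfl fun i _ => ?_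
  rw [integral_gradeDist (by fun_prop)]
  congr 1
  have h1 := (hφ i).integral_mul_fst (M.ability_supp i) hQ.measurable (C := 1)
    fun x => abs_le.2 ⟨by linarith [(hmem x).1], (hmem x).2⟩
  simp only [mul_comm (M.desirability φ _)] at h1
  exact h1

lemma integral_id_aggregateGrade (huniform : M.aggregateAbility = volume.restrict (Icc 0 1))
    (hφ : M.IsProfile φ) : ∫ x, x ∂(M.aggregateGrade φ) = 1 / 2 := by
  have := M.ability_prob
  have := M.isProbabilityMeasure_gradeDist hφ
  have hi : ∀ i, Integrable (fun a => a) (M.ability i) := fun i =>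
    integrable_of_continuous_of_mem_Icc measurable_id (M.ability_supp i) continuous_id
  rw [aggregateGrade, M.integral_sum_weight (f := fun x => x) fun i =>
    integrable_of_continuous_of_mem_Icc measurable_id (M.ae_gradeDist_mem_Icc hφ i) continuous_id]
  calc ∑ i, (M.weight i : ℝ) * ∫ x, x ∂(gradeDist (M.ability i) (φ i))
      = ∑ i, (M.weight i : ℝ) * ∫ a, a ∂(M.ability i) := by
        refine Finset.sum_congr rfl fun i _ => ?_
        have := (hφ i).markov
        have e : (M.ability i ⊗ₘ φ i).map Prod.fst = M.ability i :=
          Measure.fst_compProd (M.ability i) (φ i)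
        have h1 := (hφ i).setIntegral_fst (M.ability_supp i) MeasurableSet.univ
        simp only [preimage_univ, Measure.restrict_univ] at h1
        rw [integral_gradeDist (Q := fun x => x) measurable_id, ← h1, ← integral_map
          (f := fun x => x) measurable_fst.aemeasurable aestronglyMeasurable_id, e]
    _ = 1 / 2 := by
        rw [integral_aggregateAbility huniform hi]
        simp

lemma IsEquilibrium.truthfulWelfare_le (h : M.IsEquilibrium φ)
    (huniform : M.aggregateAbility = volume.restrict (Icc 0 1)) (hconn : M.IsConnected φ) :
    M.truthfulWelfare id id ≤ 1.36 * M.welfare id id φ := by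
  have := M.ability_prob
  have := M.isProbabilityMeasure_gradeDist h.1
  have := h.nullSingletonClass_aggregateGrade huniform
  have := M.isProbabilityMeasure_aggregateGrade h.1
  have hc := M.continuous_desirability h.1
  obtain ⟨P, hPc, hPm, hP0, hPconv, hPQ, hPint⟩ := h.exists_convex_extension huniform hconn
  have hae : ∀ᵐ x ∂(M.aggregateGrade φ), P x = M.desirability φ x :=
    (M.ae_le_sSup_support h.1).mono hPQ
  have hsum : ∫ x in (0 : ℝ)..1, P x ≤ ∫ x, P x ∂(M.aggregateGrade φ) := by
    rw [integral_congr_ae hae, aggregateGrade, M.integral_sum_weight (f := M.desirability φ) fun i =>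
      integrable_of_continuous_of_mem_Icc measurable_id (M.ae_gradeDist_mem_Icc h.1 i) hc,
      ← integral_aggregateAbility (f := P) huniform fun i =>
        integrable_of_continuous_of_mem_Icc measurable_id (M.ability_supp i) hPc]
    exact Finset.sum_le_sum fun i _ => mul_le_mul_of_nonneg_left (hPint i) (M.weight i).2
  rw [truthfulWelfare_eq huniform, welfare_eq h.1 hc,
    integral_congr_ae (g := fun x => x * P x) (hae.mono fun x hx => by simp only [hx])]
  exact truthful_le_of_convex _ (M.ae_aggregateGrade_iff.2 (M.ae_gradeDist_mem_Icc h.1))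
    (integral_id_aggregateGrade huniform h.1) M.continuousOn_jobQuantile hPc hPm hP0 hPconv
    (hae.mono fun x hx => hx.trans (M.desirability_eq_jobQuantile x)) hsum

end Market

end Grading

theorem theorem4p2 {ι : Type*} [Fintype ι] (M : Grading.Market ι)
    (huniform : M.aggregateAbility = volume.restrict (Set.Icc 0 1)) :
    M.priceOfAnarchy id id ≤ ENNReal.ofReal 1.36 := by
  refine iSup_le fun φ => iSup_le fun h => iSup_le fun hconn => ?_
  -- This also covers a zero denominator: the product bound then makes the numerator zero, and `0 /
  -- 0 = 0`.
  refine ENNReal.div_le_of_le_mul ?_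
  rw [← ENNReal.ofReal_mul (by norm_num)]
  exact ENNReal.ofReal_le_ofReal (h.truthfulWelfare_le huniform hconn)
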